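/- Let $k$ be an algebraically closed field of characteristic not equal to $2$ or $3$, let $W=k[t_0,t_1]_1$, and let $\mathrm{Gr}(2,4)=\mathrm{Gr}(2,\mathrm{Sym}^3W)$ be the Grassmannian of pencils (two-dimensional subspaces) of binary cubic forms over $k$, with the action of $\mathrm{PGL}_2=\mathrm{PGL}_2(k)$ by linear changes of the variables $t_0,t_1$. For a pencil $p=\langle f,g\rangle$ with $f=\sum_{i=0}^3 a_it_0^{3-i}t_1^i$ and $g=\sum_{i=0}^3 b_it_0^{3-i}t_1^i$ put $p_{ij}=a_ib_j-a_jb_i$, $$I'=3p_{03}-p_{12},\qquad J=c_0c_2c_4+2c_1c_2c_3-c_0c_3^2-c_1^2c_4-c_2^3,$$ where $(c_0:4c_1:6c_2:4c_3:c_4)=(p_{01}:2p_{02}:3p_{03}+p_{12}:-2p_{31}:p_{23})$, with equal coordinates (not only proportional ones). The vanishing of $I'$ or of $J$ at $p$ does not depend on the choice of $f,g$. Let $$\mathcal O_{A_4}=\{p\in\mathrm{Gr}(2,4)\mid I'|_p=0,\ J|_p\neq 0\}.$$ A pencil $p$ is called $\mathrm{PGL}_2$-stable, written $p\in\mathrm{Gr}(2,4)^s$,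 if it is stable in the sense of geometric invariant theory for the Plücker embedding: its stabilizer is finite (equivalently, its orbit has dimension $\dim\mathrm{PGL}_2$), and there is an invariant homogeneous polynomial $F$ of positive degree in the Plücker coordinates with $F(p)\neq 0$ such that every orbit in the open set $\mathrm{Gr}(2,4)_F=\{F\ne 0\}$ is Zariski closed in $\mathrm{Gr}(2,4)_F$. Then: 1. $\mathcal O_{A_4}$ is a single $\mathrm{PGL}_2$-orbit (in particular it is not empty). 2. If $p\in\mathrm{Gr}(2,4)^s\setminus\mathcal O_{A_4}$, then $\mathrm{Stab}_{\mathrm{PGL}_2}(p)\cong D_4=\mathbb Z/2\times\mathbb Z/2$. 3. If $p\in\mathrm{Gr}(2,4)^s\cap\mathcal O_{A_4}$, then $\mathrm{Stab}_{\mathrm{PGL}_2}(p)$ contains a subgroup isomorphic to $D_4$. 4. If $p\in\mathcal O_{A_4}$, then $\mathrm{Stab}_{\mathrm{PGL}_2}(p)\cong A_4$, the alternating group on four letters. -/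

import Mathlib

open scoped MatrixGroups

noncomputable section

namespace BinaryCubicPencil

open MvPolynomial

variable {k : Type*} [Field k]

/-- The linear change of variables given by a `2 × 2` matrix `A`: the `k`-algebra endomorphism of
`k[t₀, t₁]` with `t_j ↦ ∑ i, A i j * t_i`. On linear forms it is the standard representation `W`
in the basis `t₀, t₁`, and on cubic forms it is `Sym³ W`. -/
def subst (A : Matrix (Fin 2) (Fin 2) k) :
    MvPolynomial (Fin 2) k →ₐ[k] MvPolynomial (Fin 2) k :=
  aeval fun j => ∑ i, C (A i j) * X i

theorem subst_X (A : Matrix (Fin 2) (Fin 2) k) (j : Fin 2) :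
    subst A (X j) = ∑ i, C (A i j) * X i := by
  simp [subst]

theorem subst_one : subst (1 : Matrix (Fin 2) (Fin 2) k) = AlgHom.id k _ := by
  apply MvPolynomial.algHom_ext
  intro j
  fin_cases j <;> simp [subst_X, Fin.sum_univ_two]

theorem subst_mul (A B : Matrix (Fin 2) (Fin 2) k) :
    subst (A * B) = (subst A).comp (subst B) := by
  apply MvPolynomial.algHom_ext
  intro j
  simp only [AlgHom.comp_apply, subst_X, map_mul, Fin.sum_univ_two, Matrix.mul_apply,
    map_add]
  simp only [← MvPolynomial.algebraMap_eq, AlgHom.commutes]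
  ring

theorem isHomogeneous_subst (A : Matrix (Fin 2) (Fin 2) k) {f : MvPolynomial (Fin 2) k} {n : ℕ}
    (hf : f.IsHomogeneous n) : (subst A f).IsHomogeneous n := by
  have h := hf.aeval (fun j => ∑ i, C (A i j) * X i) (n := 1) (fun j =>
    IsHomogeneous.sum _ _ _ fun i _ => by
      simpa using (isHomogeneous_C (Fin 2) (A i j)).mul (isHomogeneous_X k i))
  simpa [subst] using h

theorem subst_scalar (c : k) {f : MvPolynomial (Fin 2) k} {n : ℕ} (hf : f.IsHomogeneous n) :
    subst (Matrix.scalar (Fin 2) c) f = c ^ n • f := by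
  have h : ∀ j, (∑ i, C (Matrix.scalar (Fin 2) c i j) * X i : MvPolynomial (Fin 2) k)
      = C c * X j := by
    intro j
    fin_cases j <;> simp [Fin.sum_univ_two]
  rw [subst, funext h]
  conv_lhs => rw [f.as_sum]
  conv_rhs => rw [f.as_sum]
  rw [map_sum, Finset.smul_sum]
  refine Finset.sum_congr rfl fun d hd => ?_
  have hdeg : d.degree = n := by
    by_contra hne
    exact (mem_support_iff.mp hd) (hf.coeff_eq_zero hne)
  rw [aeval_monomial, smul_monomial, ← hdeg, Finsupp.degree_eq_sum, Fin.sum_univ_two,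
    Finsupp.prod_fintype _ _ (by simp), Fin.prod_univ_two, monomial_eq,
    Finsupp.prod_fintype _ _ (by simp), Fin.prod_univ_two, MvPolynomial.algebraMap_eq]
  simp only [mul_pow, pow_add, map_mul, map_pow, smul_eq_mul]
  ring

variable (k) in
/-- The Grassmannian `Gr(2, 4) = Gr(2, Sym³ W)`: its points are the pencils of binary cubics,
that is, the two-dimensional subspaces of the space of binary cubic forms. -/
abbrev Pencil : Type _ :=
  {p : Submodule k (MvPolynomial (Fin 2) k) //
    p ≤ homogeneousSubmodule (Fin 2) k 3 ∧ Module.finrank k p = 2}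

theorem subst_injective (A : GL (Fin 2) k) :
    Function.Injective (subst (A : Matrix (Fin 2) (Fin 2) k)) := by
  intro f g hfg
  have h := congrArg (subst ((A⁻¹ : GL (Fin 2) k) : Matrix (Fin 2) (Fin 2) k)) hfg
  rw [← AlgHom.comp_apply, ← AlgHom.comp_apply, ← subst_mul, ← Units.val_mul, inv_mul_cancel,
    Units.val_one, subst_one] at h
  simpa using h

/-- `GL₂` acts on pencils by moving all members of the pencil. -/
instance : MulAction (GL (Fin 2) k) (Pencil k) where
  smul A p :=
    ⟨p.1.map (subst (A : Matrix (Fin 2) (Fin 2) k)).toLinearMap, by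
      constructor
      · rintro _ ⟨f, hf, rfl⟩
        exact isHomogeneous_subst _ (p.2.1 hf)
      · exact (Submodule.equivMapOfInjective _ (subst_injective A) p.1).finrank_eq.symm.trans
          p.2.2⟩
  one_smul p := by
    apply Subtype.ext
    change p.1.map (subst ((1 : GL (Fin 2) k) : Matrix (Fin 2) (Fin 2) k)).toLinearMap = p.1
    rw [Units.val_one, subst_one]
    exact Submodule.map_id p.1
  mul_smul A B p := by
    apply Subtype.ext
    change p.1.map (subst ((A * B : GL (Fin 2) k) : Matrix (Fin 2) (Fin 2) k)).toLinearMap =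
      (p.1.map (subst (B : Matrix (Fin 2) (Fin 2) k)).toLinearMap).map
        (subst (A : Matrix (Fin 2) (Fin 2) k)).toLinearMap
    rw [Units.val_mul, subst_mul, ← Submodule.map_comp]
    rfl

theorem smul_val (A : GL (Fin 2) k) (p : Pencil k) :
    (A • p).1 = p.1.map (subst (A : Matrix (Fin 2) (Fin 2) k)).toLinearMap := rfl

theorem scalar_smul (u : kˣ) (p : Pencil k) :
    Matrix.GeneralLinearGroup.scalar (Fin 2) u • p = p := by
  apply Subtype.ext
  rw [smul_val]
  have h : ∀ f ∈ p.1, subst ((Matrix.GeneralLinearGroup.scalar (Fin 2) u : GL (Fin 2) k) :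
      Matrix (Fin 2) (Fin 2) k) f = (u : k) ^ 3 • f := fun f hf => by
    rw [← subst_scalar (u : k) (p.2.1 hf)]
    rfl
  apply le_antisymm
  · rintro _ ⟨f, hf, rfl⟩
    change subst _ f ∈ p.1
    rw [h f hf]
    exact p.1.smul_mem _ hf
  · intro f hf
    refine ⟨((u : k) ^ 3)⁻¹ • f, p.1.smul_mem _ hf, ?_⟩
    change subst _ _ = f
    rw [map_smul, h f hf, smul_smul, inv_mul_cancel₀ (pow_ne_zero _ u.ne_zero), one_smul]

/-- The action of `PGL₂(k)` on `Gr(2, 4)`. -/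
instance : MulAction PGL(2, k) (Pencil k) :=
  Matrix.ProjGenLinGroup.mulActionOfGL scalar_smul

/-- The coefficient of `t₀ ^ (3 - i) * t₁ ^ i` in `f`. -/
def cubicCoeff (f : MvPolynomial (Fin 2) k) (i : Fin 4) : k :=
  f.coeff (Finsupp.single 0 (3 - (i : ℕ)) + Finsupp.single 1 (i : ℕ))

/-- The Plücker coordinates `p_ij = a_i b_j - a_j b_i` of a pair of binary cubics with
coefficients `a_i` and `b_i`. -/
def plucker (f g : MvPolynomial (Fin 2) k) (ij : Fin 4 × Fin 4) : k :=
  cubicCoeff f ij.1 * cubicCoeff g ij.2 - cubicCoeff f ij.2 * cubicCoeff g ij.1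

/-- A (homogeneous) polynomial `F` in the Plücker coordinates vanishes at the pencil `p`. -/
def VanishesAt (F : MvPolynomial (Fin 4 × Fin 4) k) (p : Pencil k) : Prop :=
  ∀ f g : MvPolynomial (Fin 2) k, Submodule.span k {f, g} = p.1 → eval (plucker f g) F = 0

/-- The open set of pencils at which `F` does not vanish. -/
def nonvanishingLocus (F : MvPolynomial (Fin 4 × Fin 4) k) : Set (Pencil k) :=
  {p | ¬ VanishesAt F p}

/-- `Z ∩ U` is closed in `U` for the topology induced by the Zariski topology of `Gr(2, 4)` in
its Plücker embedding: it is cut out in `U` by homogeneous polynomials in the Plücker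
coordinates. -/
def IsZariskiClosedIn (U Z : Set (Pencil k)) : Prop :=
  ∃ S : Set (MvPolynomial (Fin 4 × Fin 4) k), (∀ F ∈ S, ∃ d, F.IsHomogeneous d) ∧
    ∀ p ∈ U, p ∈ Z ↔ ∀ F ∈ S, VanishesAt F p

/-- The function on the affine cone over `Gr(2, 4)` defined by `F` is invariant under the linear
action of `SL₂(k)`, which has the same image as `PGL₂(k)` when `k` is algebraically closed. -/
def IsInvariant (F : MvPolynomial (Fin 4 × Fin 4) k) : Prop :=
  ∀ (A : SL(2, k)) (f g : MvPolynomial (Fin 2) k), f.IsHomogeneous 3 → g.IsHomogeneous 3 →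
    eval (plucker (subst (A : Matrix (Fin 2) (Fin 2) k) f)
      (subst (A : Matrix (Fin 2) (Fin 2) k) g)) F = eval (plucker f g) F

/-- GIT stability of a point of `Gr(2, 4)` for the action of `PGL₂` and the Plücker embedding:
the stabilizer is finite (equivalently, the orbit has the dimension of the group), and some
invariant homogeneous polynomial `F` of positive degree does not vanish at `p` and is such that
the action on the open set where `F` does not vanish is closed, that is, all orbits in this open
set are closed in it. -/
def IsStable (p : Pencil k) : Prop :=
  Finite (MulAction.stabilizer PGL(2, k) p) ∧
    ∃ (F : MvPolynomial (Fin 4 × Fin 4) k) (d : ℕ), 0 < d ∧ F.IsHomogeneous d ∧ IsInvariant F ∧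
      p ∈ nonvanishingLocus F ∧
      ∀ q ∈ nonvanishingLocus F,
        IsZariskiClosedIn (nonvanishingLocus F) (MulAction.orbit PGL(2, k) q)

variable (k) in
/-- The invariant `I' = 3 p₀₃ - p₁₂` of pencils of binary cubics. -/
def invI' : MvPolynomial (Fin 4 × Fin 4) k :=
  C 3 * X (0, 3) - X (1, 2)

/-- The invariant `J` of the binary quartic
`c₀ t₀⁴ + 4 c₁ t₀³ t₁ + 6 c₂ t₀² t₁² + 4 c₃ t₀ t₁³ + c₄ t₁⁴`. -/
def quarticJ {R : Type*} [CommRing R] (c₀ c₁ c₂ c₃ c₄ : R) : R :=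
  c₀ * c₂ * c₄ + 2 * c₁ * c₂ * c₃ - c₀ * c₃ ^ 2 - c₁ ^ 2 * c₄ - c₂ ^ 3

variable (k) in
/-- The invariant `J` of pencils of binary cubics: the invariant `J` of the Wronskian quartic,
whose coefficients (in the order of decreasing powers of `t₀`) are
`p₀₁, 2 p₀₂, 3 p₀₃ + p₁₂, -2 p₃₁, p₂₃`. -/
def invJ : MvPolynomial (Fin 4 × Fin 4) k :=
  quarticJ (X (0, 1)) (C (2 / 4) * X (0, 2)) (C (1 / 6) * (C 3 * X (0, 3) + X (1, 2)))
    (C (-2 / 4) * X (3, 1)) (X (2, 3))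

variable (k) in
/-- The set `O_{A₄}` of pencils with `I' = 0` and `J ≠ 0`. -/
def orbitA4 : Set (Pencil k) :=
  {p | VanishesAt (invI' k) p ∧ ¬ VanishesAt (invJ k) p}

end BinaryCubicPencil

end

/-!
The Wronskian (Jacobian determinant) of a pencil `⟨f, g⟩` of binary cubics is a binary quartic; its
roots are the double roots of members of the pencil. A change of coordinates moves one of these
roots to infinity, so that the pencil contains `t₁³` or `t₀ t₁²` (`exists_smul_eq_span`).

*Stability.* If the Wronskian quartic has a double root, a one-parameter subgroup of `SL₂`
degenerates the pencil either to a point where all invariants vanish, or to a pencil spanned by two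
monomials. The latter is fixed by a torus; it would lie in the closed orbit of a stable pencil,
whose stabilizer is finite (`not_isStable_of_degeneration`). Thus a stable pencil is equivalent to
`normalPencil c = ⟨t₀ t₁², t₀³ + 3 c t₀² t₁ + 2 t₁³⟩` with `c ^ 3 ≠ 2`, and the same reduction shows
that `orbitA4` is the orbit of `normalPencil 0`, since `I' = 0` forces `c = 0` and `J ≠ 0` excludes
the degenerate pencils.

*Stabilizers.* For each root `r` of the Wronskian quartic of `normalPencil c` other than `∞`, the
involution of `ℙ¹` that exchanges `∞` with `r`, and the other two roots with each other, preserves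
the pencil. Hence the stabilizer acts transitively on the four roots, and the stabilizer of `∞` in
it consists of the classes of `diag (z, 1)` with `z ^ 3 = 1` and `c z ^ 2 = c`
(`exists_eq_rootSwapPGL_mul`). For `c ≠ 0` only `z = 1` remains: the stabilizer has order four and
all its elements are involutions. For `c = 0` the stabilizer has order twelve, and it acts
faithfully on the four cosets of its subgroup of order three, so it is the alternating group.
-/

noncomputable section

namespace BinaryCubicPencil

open MvPolynomial

variable {k : Type*} [Field k]

/-! ### Binary cubics in coordinates -/

/-- The binary cubic `a t₀³ + b t₀² t₁ + c t₀ t₁² + d t₁³`. -/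
def cubic (a b c d : k) : MvPolynomial (Fin 2) k :=
  C a * X 0 ^ 3 + C b * X 0 ^ 2 * X 1 + C c * X 0 * X 1 ^ 2 + C d * X 1 ^ 3

theorem cubic_eq_sum_monomial (a b c d : k) :
    cubic a b c d = monomial (Finsupp.single 0 3 + Finsupp.single 1 0) a +
      monomial (Finsupp.single 0 2 + Finsupp.single 1 1) b +
      monomial (Finsupp.single 0 1 + Finsupp.single 1 2) c +
      monomial (Finsupp.single 0 0 + Finsupp.single 1 3) d := by
  simp only [cubic, X_pow_eq_monomial, C_mul_monomial, mul_one]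
  simp [X, monomial_mul, C_mul_monomial]

theorem isHomogeneous_cubic (a b c d : k) : (cubic a b c d).IsHomogeneous 3 := by
  rw [cubic_eq_sum_monomial]
  refine ((IsHomogeneous.add ?_ ?_).add ?_).add ?_ <;>
    exact isHomogeneous_monomial _ (by simp)

theorem exponent_eq_iff (i j i' j' : ℕ) :
    (Finsupp.single (0 : Fin 2) i + Finsupp.single 1 j =
      Finsupp.single 0 i' + Finsupp.single 1 j') ↔
      i = i' ∧ j = j' := by
  simp [Finsupp.ext_iff, Fin.forall_fin_two]

theorem cubicCoeff_cubic (a b c d : k) (i : Fin 4) :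
    cubicCoeff (cubic a b c d) i = ![a, b, c, d] i := by
  rw [cubic_eq_sum_monomial, cubicCoeff]
  simp only [coeff_add, coeff_monomial, exponent_eq_iff]
  fin_cases i <;> simp

theorem cubic_inj {a b c d a' b' c' d' : k} :
    cubic a b c d = cubic a' b' c' d' ↔ a = a' ∧ b = b' ∧ c = c' ∧ d = d' := by
  refine ⟨fun h => ?_, by rintro ⟨rfl, rfl, rfl, rfl⟩; rfl⟩
  have h' := fun i => congrArg (cubicCoeff · i) h
  simp only [cubicCoeff_cubic] at h'
  exact ⟨h' 0, h' 1, h' 2, h' 3⟩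

theorem exists_eq_cubic {f : MvPolynomial (Fin 2) k} (hf : f.IsHomogeneous 3) :
    ∃ a b c d, f = cubic a b c d := by
  refine ⟨cubicCoeff f 0, cubicCoeff f 1, cubicCoeff f 2, cubicCoeff f 3, ?_⟩
  ext m
  by_cases hm : m.degree = 3
  · have hm' : m = Finsupp.single 0 (3 - m 1) + Finsupp.single 1 (m 1) := by
      rw [Finsupp.degree_eq_sum, Fin.sum_univ_two] at hm
      ext i
      fin_cases i <;> simp; omega
    have h3 : m 1 < 4 := by
      rw [Finsupp.degree_eq_sum, Fin.sum_univ_two] at hm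
      omega
    have key : ∀ i : Fin 4, cubicCoeff f i =
        cubicCoeff (cubic (cubicCoeff f 0) (cubicCoeff f 1) (cubicCoeff f 2)
          (cubicCoeff f 3)) i := by
      intro i
      rw [cubicCoeff_cubic]
      fin_cases i <;> rfl
    rw [hm']
    exact key ⟨m 1, h3⟩
  · rw [hf.coeff_eq_zero hm, (isHomogeneous_cubic _ _ _ _).coeff_eq_zero hm]

theorem smul_cubic_add_smul_cubic (s t a b c d a' b' c' d' : k) :
    s • cubic a b c d + t • cubic a' b' c' d' =
      cubic (s * a + t * a') (s * b + t * b') (s * c + t * c') (s * d + t * d') := by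
  simp only [cubic, smul_eq_C_mul, map_add, map_mul]
  ring

theorem smul_cubic (s a b c d : k) :
    s • cubic a b c d = cubic (s * a) (s * b) (s * c) (s * d) := by
  simp only [cubic, smul_eq_C_mul, map_mul]
  ring

theorem subst_cubic (A : Matrix (Fin 2) (Fin 2) k) (a b c d : k) :
    subst A (cubic a b c d) = cubic
      (A 0 0 ^ 3 * a + A 0 0 ^ 2 * A 0 1 * b + A 0 0 * A 0 1 ^ 2 * c + A 0 1 ^ 3 * d)
      (3 * A 0 0 ^ 2 * A 1 0 * a + (A 0 0 ^ 2 * A 1 1 + 2 * A 0 0 * A 1 0 * A 0 1) * b +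
        (2 * A 0 0 * A 0 1 * A 1 1 + A 1 0 * A 0 1 ^ 2) * c + 3 * A 0 1 ^ 2 * A 1 1 * d)
      (3 * A 0 0 * A 1 0 ^ 2 * a + (A 1 0 ^ 2 * A 0 1 + 2 * A 0 0 * A 1 0 * A 1 1) * b +
        (A 0 0 * A 1 1 ^ 2 + 2 * A 0 1 * A 1 1 * A 1 0) * c + 3 * A 0 1 * A 1 1 ^ 2 * d)
      (A 1 0 ^ 3 * a + A 1 0 ^ 2 * A 1 1 * b + A 1 0 * A 1 1 ^ 2 * c + A 1 1 ^ 3 * d) := by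
  have hC : ∀ x : k, subst A (C x) = C x := fun x => by
    rw [← MvPolynomial.algebraMap_eq, AlgHom.commutes]
  simp only [cubic, map_add, map_mul, map_pow, hC, subst_X, Fin.sum_univ_two, map_ofNat]
  ring

theorem mem_span_cubic_pair {s t a b c d a' b' c' d' x y z w : k} (h0 : x = s * a + t * a')
    (h1 : y = s * b + t * b') (h2 : z = s * c + t * c') (h3 : w = s * d + t * d') :
    cubic x y z w ∈ Submodule.span k {cubic a b c d, cubic a' b' c' d'} :=
  Submodule.mem_span_pair.2 ⟨s, t, by rw [smul_cubic_add_smul_cubic, h0, h1, h2, h3]⟩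

theorem mem_span_cubic_pair_iff {a b c d a' b' c' d' x y z w : k} :
    cubic x y z w ∈ Submodule.span k {cubic a b c d, cubic a' b' c' d'} ↔
      ∃ s t, s * a + t * a' = x ∧ s * b + t * b' = y ∧ s * c + t * c' = z ∧ s * d + t * d' = w := by
  simp only [Submodule.mem_span_pair, smul_cubic_add_smul_cubic, cubic_inj]

/-! ### Pencils and their bases -/

theorem span_pair_combination (f g : MvPolynomial (Fin 2) k) {s t u v : k}
    (h : s * v - t * u ≠ 0) :
    Submodule.span k {s • f + t • g, u • f + v • g} = Submodule.span k {f, g} := by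
  apply le_antisymm
  · rw [Submodule.span_le]
    rintro x (rfl | rfl) <;> exact Submodule.mem_span_pair.2 ⟨_, _, rfl⟩
  · rw [Submodule.span_le]
    have he := inv_mul_cancel₀ h
    set e := (s * v - t * u)⁻¹
    rintro x (rfl | rfl)
    · refine Submodule.mem_span_pair.2 ⟨e * v, -e * t, ?_⟩
      match_scalars
      · linear_combination he
      · ring
    · refine Submodule.mem_span_pair.2 ⟨-e * u, e * s, ?_⟩
      match_scalars
      · ring
      · linear_combination he

theorem Pencil.finite (p : Pencil k) : Module.Finite k p.1 :=
  Module.finite_of_finrank_pos (by rw [p.2.2]; norm_num)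

theorem Pencil.eq_of_le {p q : Pencil k} (h : p.1 ≤ q.1) : p = q :=
  haveI := q.finite
  Subtype.ext (Submodule.eq_of_le_of_finrank_eq h (p.2.2.trans q.2.2.symm))

theorem Pencil.linearIndependent (p : Pencil k) {f g : MvPolynomial (Fin 2) k}
    (h : p.1 = Submodule.span k {f, g}) : LinearIndependent k ![f, g] := by
  rw [linearIndependent_iff_card_eq_finrank_span, Set.finrank, Matrix.range_cons,
    Matrix.range_cons, Matrix.range_empty, Set.union_empty, Set.singleton_union, ← h, p.2.2,
    Fintype.card_fin]

theorem Pencil.exists_basis (p : Pencil k) : ∃ a₀ a₁ a₂ a₃ b₀ b₁ b₂ b₃ : k,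
    p.1 = Submodule.span k {cubic a₀ a₁ a₂ a₃, cubic b₀ b₁ b₂ b₃} := by
  have := p.finite
  let e := Module.finBasisOfFinrankEq k p.1 p.2.2
  obtain ⟨a₀, a₁, a₂, a₃, ha⟩ := exists_eq_cubic (p.2.1 (e 0).2)
  obtain ⟨b₀, b₁, b₂, b₃, hb⟩ := exists_eq_cubic (p.2.1 (e 1).2)
  refine ⟨a₀, a₁, a₂, a₃, b₀, b₁, b₂, b₃, ?_⟩
  have h := congrArg (Submodule.map p.1.subtype) e.span_eq
  rw [Submodule.map_span, Submodule.map_top, Submodule.range_subtype] at h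
  rw [← h, ← ha, ← hb]
  congr 1
  ext x
  simp [Fin.exists_fin_two, eq_comm]

/-- The pencil spanned by two linearly independent cubics. -/
def Pencil.ofPair {a b c d a' b' c' d' : k}
    (h : LinearIndependent k ![cubic a b c d, cubic a' b' c' d']) : Pencil k :=
  ⟨Submodule.span k {cubic a b c d, cubic a' b' c' d'}, by
    rw [Submodule.span_le]
    rintro x (rfl | rfl) <;> exact isHomogeneous_cubic _ _ _ _, by
    rw [linearIndependent_iff_card_eq_finrank_span, Set.finrank, Matrix.range_cons,
      Matrix.range_cons, Matrix.range_empty, Set.union_empty, Set.singleton_union,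
      Fintype.card_fin] at h
    exact h.symm⟩

theorem smul_val_eq_span (A : GL (Fin 2) k) {p : Pencil k} {f g : MvPolynomial (Fin 2) k}
    (h : p.1 = Submodule.span k {f, g}) : (A • p).1 = Submodule.span k
      {subst (A : Matrix (Fin 2) (Fin 2) k) f, subst (A : Matrix (Fin 2) (Fin 2) k) g} := by
  rw [smul_val, h, Submodule.map_span, Set.image_pair]
  rfl

/-- Since pencils all have dimension two, a linear change of variables maps one pencil to another
as soon as it maps a basis of the first into the second. -/
theorem smul_eq_of_mem (A : GL (Fin 2) k) {p q : Pencil k} {f g : MvPolynomial (Fin 2) k}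
    (h : p.1 = Submodule.span k {f, g}) (hf : subst (A : Matrix (Fin 2) (Fin 2) k) f ∈ q.1)
    (hg : subst (A : Matrix (Fin 2) (Fin 2) k) g ∈ q.1) : A • p = q := by
  apply Pencil.eq_of_le
  rw [smul_val_eq_span A h, Submodule.span_le]
  rintro x (rfl | rfl)
  exacts [hf, hg]

theorem mk_smul_pencil (A : GL (Fin 2) k) (p : Pencil k) :
    Matrix.ProjGenLinGroup.mk A • p = A • p := rfl

/-! ### Invariant polynomials in the Plücker coordinates -/

theorem eval_smul_of_isHomogeneous {σ : Type*} {F : MvPolynomial σ k} {d : ℕ}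
    (hF : F.IsHomogeneous d) (c : k) (v : σ → k) : eval (c • v) F = c ^ d * eval v F := by
  rw [eval_eq, eval_eq, Finset.mul_sum]
  refine Finset.sum_congr rfl fun m hm => ?_
  have hdeg : m.degree = d := by
    by_contra hne
    exact (mem_support_iff.mp hm) (hF.coeff_eq_zero hne)
  simp only [Pi.smul_apply, smul_eq_mul, mul_pow, Finset.prod_mul_distrib]
  rw [Finset.prod_pow_eq_pow_sum, ← hdeg, Finsupp.degree_apply]
  ring

theorem plucker_combination (f g : MvPolynomial (Fin 2) k) (s t u v : k) :
    plucker (s • f + t • g) (u • f + v • g) = (s * v - t * u) • plucker f g := by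
  ext ij
  simp only [plucker, cubicCoeff, coeff_add, coeff_smul, smul_eq_mul, Pi.smul_apply]
  ring

theorem vanishesAt_iff {F : MvPolynomial (Fin 4 × Fin 4) k} {d : ℕ} (hF : F.IsHomogeneous d)
    {p : Pencil k} {f g : MvPolynomial (Fin 2) k} (h : p.1 = Submodule.span k {f, g}) :
    VanishesAt F p ↔ eval (plucker f g) F = 0 := by
  refine ⟨fun H => H f g h.symm, fun H f' g' h' => ?_⟩
  rw [h] at h'
  obtain ⟨s, t, rfl⟩ := Submodule.mem_span_pair.1 (h' ▸ Submodule.subset_span (by simp) :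
    f' ∈ Submodule.span k {f, g})
  obtain ⟨u, v, rfl⟩ := Submodule.mem_span_pair.1 (h' ▸ Submodule.subset_span (by simp) :
    g' ∈ Submodule.span k {f, g})
  rw [plucker_combination, eval_smul_of_isHomogeneous hF, H, mul_zero]

theorem isHomogeneous_invI' : (invI' k).IsHomogeneous 1 := by
  refine IsHomogeneous.sub ?_ (isHomogeneous_X _ _)
  simpa using (isHomogeneous_C (Fin 4 × Fin 4) (3 : k)).mul (isHomogeneous_X k (0, 3))

theorem isHomogeneous_quarticJ {σ : Type*} {F₀ F₁ F₂ F₃ F₄ : MvPolynomial σ k}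
    (h₀ : F₀.IsHomogeneous 1) (h₁ : F₁.IsHomogeneous 1) (h₂ : F₂.IsHomogeneous 1)
    (h₃ : F₃.IsHomogeneous 1) (h₄ : F₄.IsHomogeneous 1) :
    (quarticJ F₀ F₁ F₂ F₃ F₄).IsHomogeneous 3 := by
  have h2 : (2 * F₁ * F₂ * F₃).IsHomogeneous 3 := by
    have := (((isHomogeneous_C σ (2 : k)).mul h₁).mul h₂).mul h₃
    rw [map_ofNat] at this
    simpa using this
  exact (((((h₀.mul h₂).mul h₄).add h2).sub (h₀.mul (h₃.pow 2))).sub ((h₁.pow 2).mul h₄)).sub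
    (h₂.pow 3)

theorem isHomogeneous_invJ : (invJ k).IsHomogeneous 3 := by
  have hX : ∀ ij : Fin 4 × Fin 4, (X ij : MvPolynomial (Fin 4 × Fin 4) k).IsHomogeneous 1 :=
    fun ij => isHomogeneous_X k ij
  have hC : ∀ (c : k) {F : MvPolynomial (Fin 4 × Fin 4) k}, F.IsHomogeneous 1 →
      (C c * F).IsHomogeneous 1 := fun c F hF => by
    simpa using (isHomogeneous_C (Fin 4 × Fin 4) c).mul hF
  exact isHomogeneous_quarticJ (hX _) (hC _ (hX _)) (hC _ ((hC _ (hX _)).add (hX _)))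
    (hC _ (hX _)) (hX _)

theorem eval_invI'_cubic (a₀ a₁ a₂ a₃ b₀ b₁ b₂ b₃ : k) :
    eval (plucker (cubic a₀ a₁ a₂ a₃) (cubic b₀ b₁ b₂ b₃)) (invI' k) =
      3 * (a₀ * b₃ - a₃ * b₀) - (a₁ * b₂ - a₂ * b₁) := by
  simp [invI', plucker, cubicCoeff_cubic]

theorem eval_invJ_cubic (a₀ a₁ a₂ a₃ b₀ b₁ b₂ b₃ : k) :
    eval (plucker (cubic a₀ a₁ a₂ a₃) (cubic b₀ b₁ b₂ b₃)) (invJ k) =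
      quarticJ (a₀ * b₁ - a₁ * b₀) (2 / 4 * (a₀ * b₂ - a₂ * b₀))
        (1 / 6 * (3 * (a₀ * b₃ - a₃ * b₀) + (a₁ * b₂ - a₂ * b₁)))
        (-2 / 4 * (a₃ * b₁ - a₁ * b₃)) (a₂ * b₃ - a₃ * b₂) := by
  simp only [invJ, quarticJ, plucker, cubicCoeff_cubic, map_add, map_sub, map_mul, map_pow,
    eval_X, eval_C, map_ofNat]
  simp

theorem eval_invI'_subst (A : Matrix (Fin 2) (Fin 2) k) (a₀ a₁ a₂ a₃ b₀ b₁ b₂ b₃ : k) :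
    eval (plucker (subst A (cubic a₀ a₁ a₂ a₃)) (subst A (cubic b₀ b₁ b₂ b₃))) (invI' k) =
      A.det ^ 3 * eval (plucker (cubic a₀ a₁ a₂ a₃) (cubic b₀ b₁ b₂ b₃)) (invI' k) := by
  rw [subst_cubic, subst_cubic, eval_invI'_cubic, eval_invI'_cubic, Matrix.det_fin_two]
  ring

/-- The invariance of `J` under linear substitutions: the arguments on the left are the coefficients
(divided by `1, 4, 6, 4, 1`) of the quartic with coefficients `c₀, 4 c₁, 6 c₂, 4 c₃, c₄` after the
substitution `t₀ ↦ α t₀ + γ t₁`, `t₁ ↦ β t₀ + δ t₁`. -/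
theorem quarticJ_transform (α β γ δ c₀ c₁ c₂ c₃ c₄ : k) :
    quarticJ
      (α ^ 4 * c₀ + 4 * α ^ 3 * β * c₁ + 6 * α ^ 2 * β ^ 2 * c₂ + 4 * α * β ^ 3 * c₃ + β ^ 4 * c₄)
      (α ^ 3 * γ * c₀ + (α ^ 3 * δ + 3 * α ^ 2 * β * γ) * c₁ +
        3 * (α ^ 2 * β * δ + α * β ^ 2 * γ) * c₂ + (3 * α * β ^ 2 * δ + β ^ 3 * γ) * c₃ +
        β ^ 3 * δ * c₄)
      (α ^ 2 * γ ^ 2 * c₀ + 2 * (α ^ 2 * γ * δ + α * β * γ ^ 2) * c₁ +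
        (α ^ 2 * δ ^ 2 + 4 * α * β * γ * δ + β ^ 2 * γ ^ 2) * c₂ +
        2 * (α * β * δ ^ 2 + β ^ 2 * γ * δ) * c₃ + β ^ 2 * δ ^ 2 * c₄)
      (γ ^ 3 * α * c₀ + (γ ^ 3 * β + 3 * γ ^ 2 * δ * α) * c₁ +
        3 * (γ ^ 2 * δ * β + γ * δ ^ 2 * α) * c₂ + (3 * γ * δ ^ 2 * β + δ ^ 3 * α) * c₃ +
        δ ^ 3 * β * c₄)
      (γ ^ 4 * c₀ + 4 * γ ^ 3 * δ * c₁ + 6 * γ ^ 2 * δ ^ 2 * c₂ + 4 * γ * δ ^ 3 * c₃ +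
        δ ^ 4 * c₄) =
      (α * δ - β * γ) ^ 6 * quarticJ c₀ c₁ c₂ c₃ c₄ := by
  simp only [quarticJ]
  ring

theorem quarticJ_smul (e c₀ c₁ c₂ c₃ c₄ : k) :
    quarticJ (e * c₀) (e * c₁) (e * c₂) (e * c₃) (e * c₄) =
      e ^ 3 * quarticJ c₀ c₁ c₂ c₃ c₄ := by
  simp only [quarticJ]
  ring

/-- The Wronskian quartic of a pencil is a covariant, so that its invariant `J` is an invariant of
the pencil. -/
theorem eval_invJ_subst (h2 : (2 : k) ≠ 0) (h3 : (3 : k) ≠ 0) (A : Matrix (Fin 2) (Fin 2) k)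
    (a₀ a₁ a₂ a₃ b₀ b₁ b₂ b₃ : k) :
    eval (plucker (subst A (cubic a₀ a₁ a₂ a₃)) (subst A (cubic b₀ b₁ b₂ b₃))) (invJ k) =
      A.det ^ 9 * eval (plucker (cubic a₀ a₁ a₂ a₃) (cubic b₀ b₁ b₂ b₃)) (invJ k) := by
  have h4 : (4 : k) ≠ 0 := by
    rw [show (4 : k) = 2 * 2 by norm_num]
    exact mul_ne_zero h2 h2
  have h6 : (6 : k) ≠ 0 := by
    rw [show (6 : k) = 2 * 3 by norm_num]
    exact mul_ne_zero h2 h3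
  rw [subst_cubic, subst_cubic, eval_invJ_cubic, eval_invJ_cubic, Matrix.det_fin_two,
    show (9 : ℕ) = 3 + 6 from rfl, pow_add,
    mul_assoc ((A 0 0 * A 1 1 - A 0 1 * A 1 0) ^ 3), ← quarticJ_transform, ← quarticJ_smul]
  congr 1
  · field_simp; ring
  · field_simp; ring
  · field_simp; ring
  · field_simp; ring
  · field_simp; ring

theorem mem_orbitA4_iff {p : Pencil k} {a₀ a₁ a₂ a₃ b₀ b₁ b₂ b₃ : k}
    (h : p.1 = Submodule.span k {cubic a₀ a₁ a₂ a₃, cubic b₀ b₁ b₂ b₃}) :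
    p ∈ orbitA4 k ↔ 3 * (a₀ * b₃ - a₃ * b₀) - (a₁ * b₂ - a₂ * b₁) = 0 ∧
      quarticJ (a₀ * b₁ - a₁ * b₀) (2 / 4 * (a₀ * b₂ - a₂ * b₀))
        (1 / 6 * (3 * (a₀ * b₃ - a₃ * b₀) + (a₁ * b₂ - a₂ * b₁)))
        (-2 / 4 * (a₃ * b₁ - a₁ * b₃)) (a₂ * b₃ - a₃ * b₂) ≠ 0 := by
  rw [← eval_invI'_cubic, ← eval_invJ_cubic, ← vanishesAt_iff isHomogeneous_invI' h, Ne,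
    ← vanishesAt_iff isHomogeneous_invJ h]
  rfl

theorem smul_mem_orbitA4_iff (h2 : (2 : k) ≠ 0) (h3 : (3 : k) ≠ 0) (A : GL (Fin 2) k)
    (p : Pencil k) : A • p ∈ orbitA4 k ↔ p ∈ orbitA4 k := by
  obtain ⟨a₀, a₁, a₂, a₃, b₀, b₁, b₂, b₃, h⟩ := p.exists_basis
  have hA : (A : Matrix (Fin 2) (Fin 2) k).det ≠ 0 := A.det.ne_zero
  change VanishesAt _ _ ∧ ¬ VanishesAt _ _ ↔ VanishesAt _ _ ∧ ¬ VanishesAt _ _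
  rw [vanishesAt_iff isHomogeneous_invI' h, vanishesAt_iff isHomogeneous_invJ h,
    vanishesAt_iff isHomogeneous_invI' (smul_val_eq_span A h),
    vanishesAt_iff isHomogeneous_invJ (smul_val_eq_span A h), eval_invI'_subst,
    eval_invJ_subst h2 h3]
  simp [hA]

/-! ### Torus degenerations obstruct stability -/

/-- The image in `GL₂` of the diagonal torus of `PGL₂`. -/
def torus : kˣ →* GL (Fin 2) k where
  toFun z := Matrix.GeneralLinearGroup.mkOfDetNeZero !![(z : k), 0; 0, 1] (by simp)
  map_one' := by
    ext i j
    fin_cases i <;> fin_cases j <;> simp [Matrix.GeneralLinearGroup.mkOfDetNeZero]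
  map_mul' z w := by
    ext i j
    fin_cases i <;> fin_cases j <;>
      simp [Matrix.GeneralLinearGroup.mkOfDetNeZero, Matrix.mul_apply, Fin.sum_univ_two]

theorem coe_torus (z : kˣ) : (torus z : Matrix (Fin 2) (Fin 2) k) = !![(z : k), 0; 0, 1] := rfl

theorem mk_eq_mk_iff_exists {A B : GL (Fin 2) k} :
    Matrix.ProjGenLinGroup.mk A = Matrix.ProjGenLinGroup.mk B ↔
      ∃ u : kˣ, ∀ i j, A i j * u = B i j := by
  rw [Matrix.ProjGenLinGroup.mk_eq_mk_iff]
  refine exists_congr fun u => ?_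
  rw [Units.ext_iff, ← Matrix.ext_iff]
  refine forall_congr' fun i => forall_congr' fun j => ?_
  rw [Units.val_mul, Matrix.GeneralLinearGroup.coe_scalar, Matrix.scalar_apply,
    Matrix.mul_diagonal]

theorem mk_torus_injective :
    Function.Injective fun z : kˣ => Matrix.ProjGenLinGroup.mk (torus z) := by
  intro _ _ h
  obtain ⟨u, hu⟩ := mk_eq_mk_iff_exists.1 h
  have h0 := hu 0 0
  have h1 := hu 1 1
  simp only [coe_torus] at h0 h1
  simp at h0 h1
  ext
  simpa [h1] using h0

theorem infinite_units [Infinite k] : Infinite kˣ :=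
  have : Infinite {a : k // a ≠ 0} := (Set.finite_singleton (0 : k)).infinite_compl.to_subtype
  unitsEquivNeZero.infinite_iff.2 this

theorem infinite_stabilizer_of_torus [Infinite k] {q : Pencil k} (h : ∀ z : kˣ, torus z • q = q) :
    Infinite (MulAction.stabilizer PGL(2, k) q) :=
  have : Infinite kˣ := infinite_units
  Infinite.of_injective (fun z => ⟨Matrix.ProjGenLinGroup.mk (torus z), h z⟩) fun _ _ hzw =>
    mk_torus_injective (congrArg Subtype.val hzw)

/-- The diagonal torus `diag (s⁻¹, s)` of `SL₂`. -/
def diagSL (s : kˣ) : SL(2, k) := ⟨!![(s : k)⁻¹, 0; 0, s], by simp⟩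

/-- Over an algebraically closed field every element of `GL₂` acts on pencils like an element
of `SL₂`. -/
theorem exists_SL_smul_eq [IsAlgClosed k] (A : GL (Fin 2) k) :
    ∃ B : SL(2, k), ∀ p : Pencil k, A • p = (B : GL (Fin 2) k) • p := by
  obtain ⟨u, hu⟩ := IsAlgClosed.exists_pow_nat_eq (A : Matrix (Fin 2) (Fin 2) k).det
    (n := 2) (by norm_num)
  have hA : (A : Matrix (Fin 2) (Fin 2) k).det ≠ 0 := A.det.ne_zero
  have hu0 : u ≠ 0 := by
    rintro rfl
    exact hA (by simpa using hu.symm)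
  refine ⟨⟨u⁻¹ • (A : Matrix (Fin 2) (Fin 2) k), ?_⟩, fun p => ?_⟩
  · rw [Matrix.det_smul, Fintype.card_fin, ← hu]
    field_simp
  · conv_rhs => rw [← scalar_smul (Units.mk0 u hu0) p, ← mul_smul]
    congr 1
    ext i j
    rw [Units.val_mul, Matrix.GeneralLinearGroup.coe_scalar, Matrix.scalar_apply,
      Matrix.mul_diagonal]
    change A i j = (u⁻¹ • (A : Matrix (Fin 2) (Fin 2) k)) i j * u
    rw [Matrix.smul_apply, smul_eq_mul]
    field_simp

theorem smul_mem_nonvanishingLocus [IsAlgClosed k] {F : MvPolynomial (Fin 4 × Fin 4) k} {d : ℕ}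
    (hF : F.IsHomogeneous d) (hinv : IsInvariant F) (A : GL (Fin 2) k) {p : Pencil k}
    (hp : p ∈ nonvanishingLocus F) : A • p ∈ nonvanishingLocus F := by
  obtain ⟨B, hB⟩ := exists_SL_smul_eq A
  obtain ⟨a₀, a₁, a₂, a₃, b₀, b₁, b₂, b₃, h⟩ := p.exists_basis
  change ¬ VanishesAt F (A • p)
  rw [hB, vanishesAt_iff hF (smul_val_eq_span _ h), Matrix.SpecialLinearGroup.coe_GL_coe_matrix,
    hinv B _ _ (isHomogeneous_cubic _ _ _ _) (isHomogeneous_cubic _ _ _ _), ← vanishesAt_iff hF h]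
  exact hp

/-- Along a polynomial curve of pairs of cubics, a polynomial in the Plücker coordinates is a
polynomial in the parameter. -/
theorem exists_polynomial_eval_plucker (F : MvPolynomial (Fin 4 × Fin 4) k) (a₀ a₁ a₂ a₃ : k)
    (B₀ B₁ B₂ B₃ : Polynomial k) : ∃ R : Polynomial k, ∀ s, R.eval s =
      eval (plucker (cubic a₀ a₁ a₂ a₃) (cubic (B₀.eval s) (B₁.eval s) (B₂.eval s) (B₃.eval s)))
        F := by
  let a : Fin 4 → k := ![a₀, a₁, a₂, a₃]
  let B : Fin 4 → Polynomial k := ![B₀, B₁, B₂, B₃]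
  refine ⟨aeval (fun ij : Fin 4 × Fin 4 =>
    Polynomial.C (a ij.1) * B ij.2 - Polynomial.C (a ij.2) * B ij.1) F, fun s => ?_⟩
  have hB : ∀ i, (B i).eval s =
      ![B₀.eval s, B₁.eval s, B₂.eval s, B₃.eval s] i := by
    intro i
    fin_cases i <;> rfl
  rw [← Polynomial.coe_aeval_eq_eval, comp_aeval_apply, aeval_eq_eval]
  congr 2
  ext ij
  simp [plucker, cubicCoeff_cubic, Polynomial.coe_aeval_eq_eval, hB, a]

theorem eval_zero_eq_of_eval_units_eq [Infinite k] {R : Polynomial k} {c : k}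
    (h : ∀ s : kˣ, R.eval (s : k) = c) : R.eval 0 = c := by
  have := infinite_units (k := k)
  have : R = Polynomial.C c := by
    refine Polynomial.eq_of_infinite_eval_eq _ _ ((Set.infinite_range_of_injective
      (Units.val_injective (α := k))).mono ?_)
    rintro _ ⟨s, rfl⟩
    simpa using h s
  simp [this]

/-- Let a one-parameter subgroup `D` of `SL₂` rescale `f` by `(u s)⁻¹`, and let the basis
`f, (u s)⁻¹ • D s g` of the translates of the pencil `⟨f, g⟩` tend to `f, g₀` as `s → 0`. The
invariants take equal values at `(f, g)` and at `(f, g₀)`. Thus the pencil is unstable if `g₀ = 0`;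
otherwise `⟨f, g₀⟩` lies in the closure of the orbit, and if its stabilizer is infinite, it does
not lie in the orbit itself. -/
theorem not_isStable_of_degeneration [IsAlgClosed k] {p : Pencil k} {A : GL (Fin 2) k}
    {a₀ a₁ a₂ a₃ b₀ b₁ b₂ b₃ : k}
    (hp : (A • p).1 = Submodule.span k {cubic a₀ a₁ a₂ a₃, cubic b₀ b₁ b₂ b₃})
    (D : kˣ → SL(2, k)) (u : kˣ → kˣ) (B₀ B₁ B₂ B₃ : Polynomial k)
    (hf : ∀ s, (u s : k) • subst (D s : Matrix (Fin 2) (Fin 2) k) (cubic a₀ a₁ a₂ a₃) =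
      cubic a₀ a₁ a₂ a₃)
    (hg : ∀ s, (u s : k)⁻¹ • subst (D s : Matrix (Fin 2) (Fin 2) k) (cubic b₀ b₁ b₂ b₃) =
      cubic (B₀.eval (s : k)) (B₁.eval (s : k)) (B₂.eval (s : k)) (B₃.eval (s : k)))
    (h₀ : cubic (B₀.eval 0) (B₁.eval 0) (B₂.eval 0) (B₃.eval 0) = 0 ∨
      LinearIndependent k ![cubic a₀ a₁ a₂ a₃,
        cubic (B₀.eval 0) (B₁.eval 0) (B₂.eval 0) (B₃.eval 0)])
    (hinf : ∀ q : Pencil k, q.1 = Submodule.span k {cubic a₀ a₁ a₂ a₃,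
        cubic (B₀.eval 0) (B₁.eval 0) (B₂.eval 0) (B₃.eval 0)} →
      Infinite (MulAction.stabilizer PGL(2, k) q)) : ¬ IsStable p := by
  rintro ⟨hfin, F, d, hd, hF, hinv, hpF, hclosed⟩
  have hk : Infinite k := IsAlgClosed.instInfinite
  have hpF' := smul_mem_nonvanishingLocus hF hinv A hpF
  have hcurve : ∀ s : kˣ, ((D s : GL (Fin 2) k) • A • p).1 = Submodule.span k
      {cubic a₀ a₁ a₂ a₃,
        cubic (B₀.eval (s : k)) (B₁.eval (s : k)) (B₂.eval (s : k)) (B₃.eval (s : k))} := by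
    intro s
    rw [smul_val_eq_span _ hp, Matrix.SpecialLinearGroup.coe_GL_coe_matrix, ← hg,
      ← span_pair_combination (s := (u s : k)) (t := 0) (u := 0) (v := (u s : k)⁻¹)]
    · simp [hf s]
    · simp
  have hlim : eval (plucker (cubic a₀ a₁ a₂ a₃)
      (cubic (B₀.eval 0) (B₁.eval 0) (B₂.eval 0) (B₃.eval 0))) F ≠ 0 := by
    obtain ⟨R, hR⟩ := exists_polynomial_eval_plucker F a₀ a₁ a₂ a₃ B₀ B₁ B₂ B₃
    rw [← hR, eval_zero_eq_of_eval_units_eq (c := eval (plucker (cubic a₀ a₁ a₂ a₃)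
      (cubic b₀ b₁ b₂ b₃)) F)]
    · rw [Ne, ← vanishesAt_iff hF hp]
      exact hpF'
    · intro s
      rw [hR, ← hg, ← hinv (D s) _ _ (isHomogeneous_cubic _ _ _ _) (isHomogeneous_cubic _ _ _ _)]
      nth_rw 1 [← hf s]
      have := plucker_combination (subst (D s : Matrix (Fin 2) (Fin 2) k) (cubic a₀ a₁ a₂ a₃))
        (subst (D s : Matrix (Fin 2) (Fin 2) k) (cubic b₀ b₁ b₂ b₃)) (u s) 0 0 (u s : k)⁻¹
      simp only [zero_smul, add_zero, zero_add, mul_zero, sub_zero, mul_inv_cancel₀ (u s).ne_zero,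
        one_smul] at this
      rw [this]
  rcases h₀ with h₀ | h₀
  · apply hlim
    have : plucker (cubic a₀ a₁ a₂ a₃) (0 : MvPolynomial (Fin 2) k) = (0 : k) • 0 := by
      ext ij
      simp [plucker, cubicCoeff]
    rw [h₀, this, eval_smul_of_isHomogeneous hF, zero_pow hd.ne', zero_mul]
  · let q : Pencil k := Pencil.ofPair h₀
    obtain ⟨S, hS, hSq⟩ := hclosed (A • p) hpF'
    have hqF : q ∈ nonvanishingLocus F := fun hv => hlim ((vanishesAt_iff hF rfl).1 hv)
    have hq : q ∈ MulAction.orbit PGL(2, k) (A • p) := by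
      rw [hSq q hqF]
      intro G hG
      obtain ⟨e, he⟩ := hS G hG
      rw [vanishesAt_iff he (show q.1 = _ from rfl)]
      obtain ⟨R, hR⟩ := exists_polynomial_eval_plucker G a₀ a₁ a₂ a₃ B₀ B₁ B₂ B₃
      rw [← hR]
      refine eval_zero_eq_of_eval_units_eq fun s => ?_
      rw [hR, ← vanishesAt_iff he (hcurve s)]
      exact (hSq _ (smul_mem_nonvanishingLocus hF hinv _ hpF')).1
        ⟨Matrix.ProjGenLinGroup.mk (D s : GL (Fin 2) k), rfl⟩ G hG
    obtain ⟨x, hx⟩ := hq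
    have hx' : q = (x * Matrix.ProjGenLinGroup.mk A) • p := by
      rw [mul_smul]
      exact hx.symm
    have := hinf q rfl
    exact not_finite_iff_infinite.2 this
      (Finite.of_equiv _ (MulAction.stabilizerEquivStabilizer hx').toEquiv)

theorem cubic_zero : cubic (0 : k) 0 0 0 = 0 := by
  simp [cubic]

theorem linearIndependent_cubic_pair_iff {a b c d a' b' c' d' : k} :
    LinearIndependent k ![cubic a b c d, cubic a' b' c' d'] ↔
      ∀ s t, s * a + t * a' = 0 → s * b + t * b' = 0 → s * c + t * c' = 0 → s * d + t * d' = 0 →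
        s = 0 ∧ t = 0 := by
  simp only [LinearIndependent.pair_iff, smul_cubic_add_smul_cubic, ← cubic_zero, cubic_inj,
    and_imp]

theorem coe_diagSL (s : kˣ) : (diagSL s : Matrix (Fin 2) (Fin 2) k) = !![(s : k)⁻¹, 0; 0, s] := rfl

/-- The pencil degenerates to `⟨t₁³, b₀ t₀³⟩`. -/
theorem not_isStable_of_cube [IsAlgClosed k] {p : Pencil k} {A : GL (Fin 2) k} {b₀ b₁ b₂ : k}
    (hp : (A • p).1 = Submodule.span k {cubic 0 0 0 1, cubic b₀ b₁ b₂ 0}) : ¬ IsStable p := by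
  refine not_isStable_of_degeneration hp diagSL (fun s => s⁻¹ ^ 3) (.C b₀) (.C b₁ * .X ^ 2)
    (.C b₂ * .X ^ 4) 0 ?_ ?_ ?_ ?_
  · intro s
    rw [subst_cubic, smul_cubic, cubic_inj, coe_diagSL]
    simp
  · intro s
    rw [subst_cubic, smul_cubic, cubic_inj, coe_diagSL]
    simp
    field_simp
    simp
  · by_cases h : b₀ = 0
    · left
      simp [h, cubic_zero]
    · right
      rw [linearIndependent_cubic_pair_iff]
      simp +contextual [h]
  · intro q hq
    have : Infinite k := IsAlgClosed.instInfinite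
    refine infinite_stabilizer_of_torus fun z => smul_eq_of_mem _ hq ?_ ?_ <;>
    rw [hq, subst_cubic, coe_torus]
    · exact mem_span_cubic_pair (s := 1) (t := 0) (by simp) (by simp) (by simp) (by simp)
    · exact mem_span_cubic_pair (s := 0) (t := (z : k) ^ 3) (by simp) (by simp) (by simp) (by simp)

theorem infinite_stabilizer_of_monomials [IsAlgClosed k] {q : Pencil k} {b : k}
    (hq : q.1 = Submodule.span k {cubic 0 0 1 0, cubic 0 b 0 0}) :
    Infinite (MulAction.stabilizer PGL(2, k) q) := by
  have : Infinite k := IsAlgClosed.instInfinite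
  refine infinite_stabilizer_of_torus fun z => smul_eq_of_mem _ hq ?_ ?_ <;>
  rw [hq, subst_cubic, coe_torus]
  · exact mem_span_cubic_pair (s := (z : k)) (t := 0) (by simp) (by simp) (by simp) (by simp)
  · exact mem_span_cubic_pair (s := 0) (t := (z : k) ^ 2) (by simp) (by simp) (by simp) (by simp)

theorem monomials_degenerate_or_linearIndependent (b : k) : cubic 0 b 0 0 = 0 ∨
    LinearIndependent k ![cubic 0 0 1 0, cubic 0 b 0 0] := by
  by_cases h : b = 0
  · left
    simp [h, cubic_zero]
  · right
    rw [linearIndependent_cubic_pair_iff]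
    simp +contextual [h]

/-- The pencil degenerates to `⟨t₀ t₁², b₁ t₀² t₁⟩`. -/
theorem not_isStable_of_coeff_zero_eq_zero [IsAlgClosed k] {p : Pencil k} {A : GL (Fin 2) k}
    {b₁ b₃ : k}
    (hp : (A • p).1 = Submodule.span k {cubic 0 0 1 0, cubic 0 b₁ 0 b₃}) : ¬ IsStable p := by
  refine not_isStable_of_degeneration hp diagSL (fun s => s⁻¹) 0 (.C b₁) 0 (.C b₃ * .X ^ 4)
    ?_ ?_ ?_ fun q hq => infinite_stabilizer_of_monomials (b := b₁) (by simpa using hq)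
  · intro s
    rw [subst_cubic, smul_cubic, cubic_inj, coe_diagSL]
    simp
    field_simp
  · intro s
    rw [subst_cubic, smul_cubic, cubic_inj, coe_diagSL]
    simp
    field_simp
    simp
  · simpa using monomials_degenerate_or_linearIndependent b₁

/-- The pencil degenerates to `⟨t₀ t₁², b₁ t₀² t₁⟩`. -/
theorem not_isStable_of_coeff_three_eq_zero [IsAlgClosed k] {p : Pencil k} {A : GL (Fin 2) k}
    {b₀ b₁ : k}
    (hp : (A • p).1 = Submodule.span k {cubic 0 0 1 0, cubic b₀ b₁ 0 0}) : ¬ IsStable p := by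
  refine not_isStable_of_degeneration hp (fun s => diagSL s⁻¹) (fun s => s) (.C b₀ * .X ^ 2)
    (.C b₁) 0 0 ?_ ?_ ?_
    fun q hq => infinite_stabilizer_of_monomials (b := b₁) (by simpa using hq)
  · intro s
    rw [subst_cubic, smul_cubic, cubic_inj, coe_diagSL]
    simp
    field_simp
  · intro s
    rw [subst_cubic, smul_cubic, cubic_inj, coe_diagSL]
    simp
    field_simp
    simp
  · simpa using monomials_degenerate_or_linearIndependent b₁

/-! ### Normal forms of pencils -/

/-- An invertible `2 × 2` matrix given by its entries. -/
def glOf (a b c d : k) (h : a * d - b * c ≠ 0) : GL (Fin 2) k :=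
  Matrix.GeneralLinearGroup.mkOfDetNeZero !![a, b; c, d] (by rwa [Matrix.det_fin_two_of])

theorem coe_glOf (a b c d : k) (h : a * d - b * c ≠ 0) :
    (glOf a b c d h : Matrix (Fin 2) (Fin 2) k) = !![a, b; c, d] := rfl

/-- The Wronskian quartic of a pencil has a root; moving it to infinity, its leading coefficient
`p₀₁` vanishes. -/
theorem exists_smul_plucker_eq_zero [IsAlgClosed k] (p : Pencil k) :
    ∃ (A : GL (Fin 2) k) (a₀ a₁ a₂ a₃ b₀ b₁ b₂ b₃ : k),
      (A • p).1 = Submodule.span k {cubic a₀ a₁ a₂ a₃, cubic b₀ b₁ b₂ b₃} ∧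
        a₀ * b₁ - a₁ * b₀ = 0 := by
  obtain ⟨a₀, a₁, a₂, a₃, b₀, b₁, b₂, b₃, h⟩ := p.exists_basis
  by_cases h23 : a₂ * b₃ - a₃ * b₂ = 0
  · -- the quartic vanishes at the point `t₀ = 0`: swap the variables
    refine ⟨glOf 0 1 1 0 (by simp), _, _, _, _, _, _, _, _,
      (smul_val_eq_span _ h).trans (by rw [subst_cubic, subst_cubic]), ?_⟩
    simp only [coe_glOf, Matrix.of_apply, Matrix.cons_val', Matrix.cons_val_zero,
      Matrix.cons_val_one, Matrix.cons_val_fin_one]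
    linear_combination -h23
  · -- the Wronskian quartic at the point `(1, t)`, of degree exactly four in `t`
    obtain ⟨t, ht⟩ := IsAlgClosed.exists_root
      (.C (a₀ * b₁ - a₁ * b₀) + .C (2 * (a₀ * b₂ - a₂ * b₀)) * .X +
        .C (3 * (a₀ * b₃ - a₃ * b₀) + (a₁ * b₂ - a₂ * b₁)) * .X ^ 2 +
        .C (2 * (a₁ * b₃ - a₃ * b₁)) * .X ^ 3 + .C (a₂ * b₃ - a₃ * b₂) * .X ^ 4 : Polynomial k)
      (by
        rw [show Polynomial.degree _ = 4 by compute_degree!]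
        norm_num)
    refine ⟨glOf 1 t 0 1 (by simp), _, _, _, _, _, _, _, _,
      (smul_val_eq_span _ h).trans (by rw [subst_cubic, subst_cubic]), ?_⟩
    simp only [coe_glOf, Matrix.of_apply, Matrix.cons_val', Matrix.cons_val_zero,
      Matrix.cons_val_one, Matrix.cons_val_fin_one]
    simp only [Polynomial.IsRoot.def, Polynomial.eval_add, Polynomial.eval_mul,
      Polynomial.eval_C, Polynomial.eval_X, Polynomial.eval_pow] at ht
    linear_combination ht

/-- Every pencil has a member with a double root, which may be moved to infinity. -/
theorem exists_smul_double_root [IsAlgClosed k] (p : Pencil k) :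
    ∃ (A : GL (Fin 2) k) (a₂ a₃ b₀ b₁ b₂ b₃ : k),
      (A • p).1 = Submodule.span k {cubic 0 0 a₂ a₃, cubic b₀ b₁ b₂ b₃} := by
  obtain ⟨A, a₀, a₁, a₂, a₃, b₀, b₁, b₂, b₃, h, h01⟩ := exists_smul_plucker_eq_zero p
  by_cases h0 : a₀ = 0
  · by_cases h1 : a₁ = 0
    · subst h0 h1
      exact ⟨A, _, _, _, _, _, _, h⟩
    · refine ⟨A, -b₁ * a₂ + a₁ * b₂, -b₁ * a₃ + a₁ * b₃, a₀, a₁, a₂, a₃, ?_⟩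
      rw [h, ← span_pair_combination (s := -b₁) (t := a₁) (u := 1) (v := 0) _ _ (by simpa using h1),
        smul_cubic_add_smul_cubic, one_smul, zero_smul, add_zero]
      congr 3
      · linear_combination -h01
      · ring
  · refine ⟨A, -b₀ * a₂ + a₀ * b₂, -b₀ * a₃ + a₀ * b₃, a₀, a₁, a₂, a₃, ?_⟩
    rw [h, ← span_pair_combination (s := -b₀) (t := a₀) (u := 1) (v := 0) _ _ (by simpa using h0),
      smul_cubic_add_smul_cubic, one_smul, zero_smul, add_zero]
    congr 3
    · ring
    · linear_combination h01

theorem span_cubic_normalize {a c₀ c₁ c₂ c₃ : k} (ha : a ≠ 0) :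
    Submodule.span k {cubic 0 0 a 0, cubic c₀ c₁ c₂ c₃} =
      Submodule.span k {cubic 0 0 1 0, cubic c₀ c₁ 0 c₃} := by
  rw [← span_pair_combination (s := a) (t := 0) (u := c₂) (v := 1) (cubic 0 0 1 0)
    (cubic c₀ c₁ 0 c₃) (by simpa using ha), smul_cubic_add_smul_cubic, smul_cubic_add_smul_cubic]
  simp

/-- A member of a pencil with a double root is, up to coordinates, either `t₁³` or `t₀ t₁²`. -/
theorem exists_smul_eq_span [IsAlgClosed k] (p : Pencil k) : ∃ A : GL (Fin 2) k,
    (∃ b₀ b₁ b₂, (A • p).1 = Submodule.span k {cubic 0 0 0 1, cubic b₀ b₁ b₂ 0}) ∨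
      ∃ b₀ b₁ b₃, (A • p).1 = Submodule.span k {cubic 0 0 1 0, cubic b₀ b₁ 0 b₃} := by
  obtain ⟨A, a₂, a₃, b₀, b₁, b₂, b₃, h⟩ := exists_smul_double_root p
  by_cases h2 : a₂ = 0
  · subst h2
    have h3 : a₃ ≠ 0 := by
      rintro rfl
      have := linearIndependent_cubic_pair_iff.1 ((A • p).linearIndependent h) 1 0
      simp at this
    refine ⟨A, Or.inl ⟨b₀, b₁, b₂, ?_⟩⟩
    rw [h, ← span_pair_combination (s := a₃⁻¹) (t := 0) (u := -b₃ * a₃⁻¹) (v := 1) _ _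
      (by simpa using h3), smul_cubic_add_smul_cubic, smul_cubic_add_smul_cubic]
    simp [h3]
  · refine ⟨glOf 1 0 (-a₃ / a₂) 1 (by simp) * A, Or.inr ?_⟩
    have hf : subst (glOf 1 0 (-a₃ / a₂) 1 (by simp) : GL (Fin 2) k) (cubic 0 0 a₂ a₃) =
        cubic 0 0 a₂ 0 := by
      rw [subst_cubic, coe_glOf, cubic_inj]
      simp [h2]
    rw [mul_smul, smul_val_eq_span _ h, hf, subst_cubic]
    exact ⟨_, _, _, span_cubic_normalize h2⟩

/-- The pencils `⟨t₀ t₁², t₀³ + 3 c t₀² t₁ + 2 t₁³⟩`. The Wronskian quartic of such a pencil is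
`-2 t₁ (t₀³ + (3 c / 2) t₀² t₁ - t₁³)`. -/
def normalPencil (c : k) : Pencil k :=
  Pencil.ofPair (a := 0) (b := 0) (c := 1) (d := 0) (a' := 1) (b' := 3 * c) (c' := 0) (d' := 2) (by
    rw [linearIndependent_cubic_pair_iff]
    intro s t h0 _ h2 _
    exact ⟨by simpa using h2, by simpa using h0⟩)

theorem normalPencil_val (c : k) : (normalPencil c).1 =
    Submodule.span k {cubic 0 0 1 0, cubic 1 (3 * c) 0 2} := rfl

/-- Rescaling `t₀` brings the ratio of the coefficients of `t₀³` and `t₁³` to `1 : 2`. -/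
theorem exists_smul_eq_normalPencil [IsAlgClosed k] (h2 : (2 : k) ≠ 0) (h3 : (3 : k) ≠ 0)
    {p : Pencil k} {A : GL (Fin 2) k} {b₀ b₁ b₃ : k}
    (hp : (A • p).1 = Submodule.span k {cubic 0 0 1 0, cubic b₀ b₁ 0 b₃}) (hb₀ : b₀ ≠ 0)
    (hb₃ : b₃ ≠ 0) : ∃ (B : GL (Fin 2) k) (c : k), B • p = normalPencil c ∧ (b₁ = 0 → c = 0) := by
  obtain ⟨z, hz⟩ := IsAlgClosed.exists_pow_nat_eq (b₃ / (2 * b₀)) (n := 3) (by norm_num)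
  have hz0 : z ≠ 0 := by
    rintro rfl
    rw [zero_pow (by norm_num), eq_comm, div_eq_zero_iff] at hz
    simp_all
  have hz' : 2 * b₀ * z ^ 3 = b₃ := by
    rw [hz]
    field_simp
  refine ⟨torus (Units.mk0 z hz0) * A, b₁ / (3 * b₀ * z), ?_, by rintro rfl; simp⟩
  rw [mul_smul]
  refine smul_eq_of_mem _ hp ?_ ?_ <;> rw [normalPencil_val, subst_cubic, coe_torus]
  · exact mem_span_cubic_pair (s := z) (t := 0) (by simp) (by simp) (by simp) (by simp)
  · refine mem_span_cubic_pair (s := 0) (t := b₀ * z ^ 3) ?_ ?_ ?_ ?_ <;> simp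
    · ring
    · field_simp
    · linear_combination -hz'

/-- For `c ^ 3 = 2` the pencil contains the cube `(t₀ + c t₁)³`. -/
theorem not_isStable_of_smul_eq_normalPencil [IsAlgClosed k] {p : Pencil k}
    {A : GL (Fin 2) k} {c : k} (hp : A • p = normalPencil c) (hc : c ^ 3 = 2) : ¬ IsStable p := by
  -- the substitution `t₀ ↦ t₁ - c t₀`, `t₁ ↦ t₀` maps this cube to `t₁³`
  have hv := smul_val_eq_span (glOf (-c) 1 1 0 (by simp)) (normalPencil_val c)
  rw [← hp, ← mul_smul, ← span_pair_combination (s := 3 * c ^ 2) (t := 1) (u := 1) (v := 0) _ _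
    (by simp), subst_cubic, subst_cubic, smul_cubic_add_smul_cubic, smul_cubic_add_smul_cubic,
    coe_glOf] at hv
  refine not_isStable_of_cube (b₀ := -c) (b₁ := 1) (b₂ := 0) (hv.trans ?_)
  simp
  congr 3
  · linear_combination -hc
  · ring

theorem exists_smul_eq_normalPencil_of_isStable [IsAlgClosed k] (h2 : (2 : k) ≠ 0)
    (h3 : (3 : k) ≠ 0) {p : Pencil k} (hp : IsStable p) :
    ∃ (A : GL (Fin 2) k) (c : k), A • p = normalPencil c ∧ c ^ 3 ≠ 2 := by
  obtain ⟨A, ⟨b₀, b₁, b₂, h⟩ | ⟨b₀, b₁, b₃, h⟩⟩ := exists_smul_eq_span p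
  · exact absurd hp (not_isStable_of_cube h)
  · have hb₀ : b₀ ≠ 0 := by
      rintro rfl
      exact not_isStable_of_coeff_zero_eq_zero h hp
    have hb₃ : b₃ ≠ 0 := by
      rintro rfl
      exact not_isStable_of_coeff_three_eq_zero h hp
    obtain ⟨B, c, hB, -⟩ := exists_smul_eq_normalPencil h2 h3 h hb₀ hb₃
    exact ⟨B, c, hB, fun hc => not_isStable_of_smul_eq_normalPencil hB hc hp⟩

theorem normalPencil_mem_orbitA4_iff (h2 : (2 : k) ≠ 0) (h3 : (3 : k) ≠ 0) (c : k) :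
    normalPencil c ∈ orbitA4 k ↔ c = 0 := by
  rw [mem_orbitA4_iff (normalPencil_val c)]
  refine ⟨fun h => by simpa [h3] using h.1, ?_⟩
  rintro rfl
  have h4 : (4 : k) ≠ 0 := by
    rw [show (4 : k) = 2 * 2 by norm_num]
    exact mul_ne_zero h2 h2
  simp [quarticJ, h2, h4]

theorem exists_smul_eq_normalPencil_zero [IsAlgClosed k] (h2 : (2 : k) ≠ 0)
    (h3 : (3 : k) ≠ 0) {p : Pencil k} (hp : p ∈ orbitA4 k) :
    ∃ A : GL (Fin 2) k, A • p = normalPencil 0 := by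
  obtain ⟨A, ⟨b₀, b₁, b₂, h⟩ | ⟨b₀, b₁, b₃, h⟩⟩ := exists_smul_eq_span p <;>
  obtain ⟨hI, hJ⟩ := (mem_orbitA4_iff h).1 ((smul_mem_orbitA4_iff h2 h3 A p).2 hp)
  · have hb₀ : b₀ = 0 := by simpa [h3] using hI
    simp [quarticJ, hb₀] at hJ
  · have hb₁ : b₁ = 0 := by simpa using hI
    have hb₀ : b₀ ≠ 0 := by
      rintro rfl
      simp [quarticJ, hb₁] at hJ
    have hb₃ : b₃ ≠ 0 := by
      rintro rfl
      simp [quarticJ, hb₁] at hJ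
    obtain ⟨B, c, hB, hc⟩ := exists_smul_eq_normalPencil h2 h3 h hb₀ hb₃
    exact ⟨B, by rw [hB, hc hb₁]⟩

theorem orbitA4_eq_orbit [IsAlgClosed k] (h2 : (2 : k) ≠ 0) (h3 : (3 : k) ≠ 0) :
    orbitA4 k = MulAction.orbit PGL(2, k) (normalPencil (0 : k)) := by
  ext p
  constructor
  · intro hp
    obtain ⟨A, hA⟩ := exists_smul_eq_normalPencil_zero h2 h3 hp
    rw [MulAction.mem_orbit_symm]
    exact ⟨Matrix.ProjGenLinGroup.mk A, hA⟩
  · rintro ⟨x, rfl⟩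
    obtain ⟨A, rfl⟩ := Matrix.ProjGenLinGroup.mk_surjective x
    exact (smul_mem_orbitA4_iff h2 h3 A _).2 ((normalPencil_mem_orbitA4_iff h2 h3 0).2 rfl)

/-! ### Stabilizers of the normal forms -/

open Matrix.ProjGenLinGroup (mk mk_surjective)

/-- The involution of `ℙ¹` that exchanges `∞` with the root `r` of the Wronskian quartic of
`normalPencil c`, and the other two roots with each other. Its matrix does not involve `c`, because
`c` can be eliminated using `2 r³ + 3 c r² = 2`. -/
def rootSwap (r : k) (h : r ^ 2 * -r ^ 2 - r * 2 ≠ 0) : GL (Fin 2) k :=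
  glOf (r ^ 2) r 2 (-r ^ 2) h

theorem coe_rootSwap (r : k) (h : r ^ 2 * -r ^ 2 - r * 2 ≠ 0) :
    (rootSwap r h : Matrix (Fin 2) (Fin 2) k) = !![r ^ 2, r; 2, -r ^ 2] := rfl

theorem root_ne_zero (h2 : (2 : k) ≠ 0) {c r : k} (hr : 2 * r ^ 3 + 3 * c * r ^ 2 = 2) :
    r ≠ 0 := by
  rintro rfl
  simp at hr
  exact h2 hr.symm

theorem rootSwap_det_ne_zero (h2 : (2 : k) ≠ 0) (h3 : (3 : k) ≠ 0) {c r : k} (hc : c ^ 3 ≠ 2)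
    (hr : 2 * r ^ 3 + 3 * c * r ^ 2 = 2) : r ^ 2 * -r ^ 2 - r * 2 ≠ 0 := by
  intro h
  have hr3 : r ^ 3 = -2 := by
    apply mul_left_cancel₀ (root_ne_zero h2 hr)
    linear_combination -h
  have hcr : c * r ^ 2 = 2 := by
    apply mul_left_cancel₀ h3
    linear_combination hr - 2 * hr3
  -- cubing `c r² = 2` and using `r⁶ = 4` gives `4 c³ = 8`
  apply hc
  apply mul_left_cancel₀ (mul_ne_zero h2 h2)
  linear_combination (c ^ 2 * r ^ 4 + 2 * c * r ^ 2 + 4) * hcr - c ^ 3 * (r ^ 3 - 2) * hr3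

theorem mk_rootSwap_mul_self (r : k) (h : r ^ 2 * -r ^ 2 - r * 2 ≠ 0) :
    mk (rootSwap r h) * mk (rootSwap r h) = 1 := by
  rw [← map_mul, ← map_one mk, eq_comm, mk_eq_mk_iff_exists]
  refine ⟨Units.mk0 (r ^ 4 + 2 * r) (fun h' => h (by linear_combination -h')), fun i j => ?_⟩
  rw [Units.val_mul, coe_rootSwap]
  fin_cases i <;> fin_cases j <;> simp [Matrix.mul_apply, Fin.sum_univ_two] <;> ring

theorem rootSwap_smul_normalPencil {c r : k} (h : r ^ 2 * -r ^ 2 - r * 2 ≠ 0)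
    (hr : 2 * r ^ 3 + 3 * c * r ^ 2 = 2) : rootSwap r h • normalPencil c = normalPencil c := by
  refine smul_eq_of_mem _ (normalPencil_val c) ?_ ?_ <;>
  rw [normalPencil_val, subst_cubic, coe_rootSwap]
  -- the coefficients of the combinations are those of `t₀ t₁²` and of `t₀³` in the images
  · refine mem_span_cubic_pair (s := r ^ 6 - 4 * r ^ 3) (t := r ^ 4) ?_ ?_ ?_ ?_ <;> simp
    · ring
    · linear_combination -r ^ 2 * hr
    · ring
    · ring
  · refine mem_span_cubic_pair (s := 12 * r ^ 2 + (4 * r - 4 * r ^ 4) * (3 * c) + 6 * r ^ 5)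
      (t := 4 * r ^ 3 - r ^ 6) ?_ ?_ ?_ ?_ <;> simp
    · linear_combination r ^ 3 * hr
    · ring
    · ring
    · linear_combination -4 * hr

theorem torus_smul_normalPencil {c : k} {z : kˣ} (hz : z ^ 3 = 1) (hcz : c * z ^ 2 = c) :
    torus z • normalPencil c = normalPencil c := by
  have hz' : (z : k) ^ 3 = 1 := by rw [← Units.val_pow_eq_pow_val, hz, Units.val_one]
  refine smul_eq_of_mem _ (normalPencil_val c) ?_ ?_ <;>
  rw [normalPencil_val, subst_cubic, coe_torus]
  · exact mem_span_cubic_pair (s := (z : k)) (t := 0) (by simp) (by simp) (by simp) (by simp)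
  · refine mem_span_cubic_pair (s := 0) (t := 1) ?_ ?_ ?_ ?_ <;> simp
    · exact hz'
    · linear_combination 3 * hcz

theorem subst_mem_of_smul_eq {A : GL (Fin 2) k} {p q : Pencil k} (hA : A • p = q)
    {f : MvPolynomial (Fin 2) k} (hf : f ∈ p.1) :
    subst (A : Matrix (Fin 2) (Fin 2) k) f ∈ q.1 :=
  hA ▸ Submodule.mem_map_of_mem hf

/-- An element of the stabilizer that fixes the root `∞` of the Wronskian quartic is diagonal. -/
theorem exists_mk_eq_mk_torus (h2 : (2 : k) ≠ 0) (h3 : (3 : k) ≠ 0) {c : k} {A : GL (Fin 2) k}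
    (hA : A • normalPencil c = normalPencil c) (h01 : A 0 1 = 0) :
    ∃ z : kˣ, z ^ 3 = 1 ∧ c * z ^ 2 = c ∧ mk A = mk (torus z) := by
  have hdet : (A : Matrix (Fin 2) (Fin 2) k).det ≠ 0 := A.det.ne_zero
  rw [Matrix.det_fin_two, h01, zero_mul, sub_zero] at hdet
  have h00 := left_ne_zero_of_mul hdet
  have h11 := right_ne_zero_of_mul hdet
  have hf := subst_mem_of_smul_eq hA (Submodule.subset_span (Set.mem_insert _ _))
  have hg := subst_mem_of_smul_eq hA (Submodule.subset_span (Set.mem_insert_of_mem _ rfl))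
  rw [subst_cubic, h01, normalPencil_val, mem_span_cubic_pair_iff] at hf hg
  obtain ⟨s, t, e0, -, -, e3⟩ := hf
  obtain ⟨s', t', e0', e1', -, e3'⟩ := hg
  have h10 : A 1 0 = 0 := by
    have ht : t = 0 := by linear_combination e0
    rw [ht] at e3
    simpa [h11] using e3.symm
  rw [h10] at e1' e3'
  have ht' : t' = A 0 0 ^ 3 := by linear_combination e0'
  have h33 : A 0 0 ^ 3 = A 1 1 ^ 3 := by
    apply mul_left_cancel₀ h2
    linear_combination e3' - 2 * ht'
  have hcA : c * A 0 0 = c * A 1 1 := by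
    apply mul_left_cancel₀ (mul_ne_zero h3 (pow_ne_zero 2 h00))
    linear_combination e1' - 3 * c * ht'
  have hz : A 0 0 / A 1 1 ≠ 0 := div_ne_zero h00 h11
  refine ⟨Units.mk0 _ hz, ?_, ?_, ?_⟩
  · ext
    rw [Units.val_pow_eq_pow_val, Units.val_mk0, Units.val_one, div_pow, h33, div_self]
    exact pow_ne_zero 3 h11
  · rw [Units.val_mk0]
    field_simp
    linear_combination (A 0 0 + A 1 1) * hcA
  · rw [mk_eq_mk_iff_exists]
    refine ⟨Units.mk0 _ (inv_ne_zero h11), fun i j => ?_⟩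
    rw [coe_torus]
    fin_cases i <;> fin_cases j <;> simp [h01, h10, h11, div_eq_mul_inv]

/-- An element `A` of the stabilizer that moves the root `∞` maps it to another root `r`, and then
`rootSwap r` moves it back. -/
theorem exists_root_of_smul_normalPencil {c : k} {A : GL (Fin 2) k}
    (hA : A • normalPencil c = normalPencil c) (h01 : A 0 1 ≠ 0) :
    ∃ r : k, 2 * r ^ 3 + 3 * c * r ^ 2 = 2 ∧ r * A 0 1 = -A 1 1 := by
  have hdet : (A : Matrix (Fin 2) (Fin 2) k).det ≠ 0 := A.det.ne_zero
  rw [Matrix.det_fin_two] at hdet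
  have hf := subst_mem_of_smul_eq hA (Submodule.subset_span (Set.mem_insert _ _))
  rw [subst_cubic, normalPencil_val, mem_span_cubic_pair_iff] at hf
  obtain ⟨s, t, e0, e1, -, e3⟩ := hf
  have ht : t = A 0 0 * A 0 1 ^ 2 := by linear_combination e0
  have h00 : A 0 0 ≠ 0 := by
    intro h
    rw [h, zero_mul] at ht
    rw [h, ht] at e1
    have : A 1 0 = 0 := by simpa [h01] using e1.symm
    simp [h, this] at hdet
  refine ⟨-A 1 1 / A 0 1, ?_, by field_simp⟩
  field_simp
  apply mul_left_cancel₀ h00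
  apply mul_left_cancel₀ (pow_ne_zero 2 h01)
  linear_combination (A 1 1 ^ 2 * A 0 1) * (e1 - 3 * c * ht) - A 0 1 ^ 3 * (e3 - 2 * ht)

/-- The roots other than `∞` of the Wronskian quartic of `normalPencil c`. -/
abbrev Root (c : k) : Type _ := {r : k // 2 * r ^ 3 + 3 * c * r ^ 2 = 2}

/-- The diagonal elements of the stabilizer of `normalPencil c`. -/
abbrev TorusStab (c : k) : Type _ := {z : kˣ // z ^ 3 = 1 ∧ c * z ^ 2 = c}

/-- The element of the stabilizer of `normalPencil c` that exchanges `∞` with another root of the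
Wronskian quartic; the value `none` stands for the root `∞` itself. -/
def rootSwapPGL (h2 : (2 : k) ≠ 0) (h3 : (3 : k) ≠ 0) {c : k} (hc : c ^ 3 ≠ 2) :
    Option (Root c) → PGL(2, k)
  | none => 1
  | some r => mk (rootSwap r.1 (rootSwap_det_ne_zero h2 h3 hc r.2))

theorem rootSwapPGL_mul_self (h2 : (2 : k) ≠ 0) (h3 : (3 : k) ≠ 0) {c : k} (hc : c ^ 3 ≠ 2)
    (o : Option (Root c)) : rootSwapPGL h2 h3 hc o * rootSwapPGL h2 h3 hc o = 1 := by
  cases o with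
  | none => exact one_mul 1
  | some r => exact mk_rootSwap_mul_self _ _

theorem rootSwapPGL_smul (h2 : (2 : k) ≠ 0) (h3 : (3 : k) ≠ 0) {c : k} (hc : c ^ 3 ≠ 2)
    (o : Option (Root c)) : rootSwapPGL h2 h3 hc o • normalPencil c = normalPencil c := by
  cases o with
  | none => exact one_smul _ _
  | some r => exact rootSwap_smul_normalPencil _ r.2

/-- The stabilizer acts transitively on the four roots of the Wronskian quartic, by means of the
elements `rootSwapPGL`, and the stabilizer of the root `∞` consists of diagonal elements. -/
theorem exists_eq_rootSwapPGL_mul (h2 : (2 : k) ≠ 0) (h3 : (3 : k) ≠ 0) {c : k} (hc : c ^ 3 ≠ 2)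
    {x : PGL(2, k)} (hx : x • normalPencil c = normalPencil c) :
    ∃ (o : Option (Root c)) (z : TorusStab c), x = rootSwapPGL h2 h3 hc o * mk (torus z.1) := by
  obtain ⟨A, rfl⟩ := mk_surjective x
  by_cases h01 : A 0 1 = 0
  · obtain ⟨z, hz, hcz, h⟩ := exists_mk_eq_mk_torus h2 h3 hx h01
    exact ⟨none, ⟨z, hz, hcz⟩, h.trans (one_mul _).symm⟩
  · obtain ⟨r, hr, hrA⟩ := exists_root_of_smul_normalPencil hx h01
    have hd := rootSwap_det_ne_zero h2 h3 hc hr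
    have hB : (rootSwap r hd * A) • normalPencil c = normalPencil c := by
      rw [mul_smul]
      exact (congrArg _ hx).trans (rootSwap_smul_normalPencil hd hr)
    obtain ⟨z, hz, hcz, h⟩ := exists_mk_eq_mk_torus h2 h3 hB (by
      rw [Units.val_mul, coe_rootSwap]
      simp [Matrix.mul_apply, Fin.sum_univ_two]
      linear_combination r * hrA)
    refine ⟨some ⟨r, hr⟩, ⟨z, hz, hcz⟩, ?_⟩
    change mk A = mk (rootSwap r hd) * mk (torus z)
    rw [← h, map_mul, ← mul_assoc, mk_rootSwap_mul_self, one_mul]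

theorem rootSwapPGL_mul_injective (h2 : (2 : k) ≠ 0) (h3 : (3 : k) ≠ 0) {c : k} (hc : c ^ 3 ≠ 2)
    {o o' : Option (Root c)} {z z' : kˣ} (h : rootSwapPGL h2 h3 hc o * mk (torus z) =
      rootSwapPGL h2 h3 hc o' * mk (torus z')) : o = o' ∧ z = z' := by
  have ho : o = o' := by
    have hr0 : ∀ r : Root c, r.1 ≠ 0 := fun r => root_ne_zero h2 r.2
    match o, o' with
    | none, none => rfl
    | none, some r =>
      exfalso
      simp only [rootSwapPGL, one_mul, ← map_mul] at h
      obtain ⟨u, hu⟩ := mk_eq_mk_iff_exists.1 h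
      have h01 := hu 0 1
      rw [Units.val_mul, coe_torus, coe_torus, coe_rootSwap] at h01
      simp [Matrix.mul_apply, Fin.sum_univ_two] at h01
      exact hr0 r h01.symm
    | some r, none =>
      exfalso
      simp only [rootSwapPGL, one_mul, ← map_mul] at h
      obtain ⟨u, hu⟩ := mk_eq_mk_iff_exists.1 h
      have h01 := hu 0 1
      rw [Units.val_mul, coe_torus, coe_torus, coe_rootSwap] at h01
      simp [Matrix.mul_apply, Fin.sum_univ_two] at h01
      exact hr0 r h01
    | some r, some r' =>
      simp only [rootSwapPGL, ← map_mul] at h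
      obtain ⟨u, hu⟩ := mk_eq_mk_iff_exists.1 h
      have h01 := hu 0 1
      have h11 := hu 1 1
      rw [Units.val_mul, Units.val_mul, coe_torus, coe_torus, coe_rootSwap, coe_rootSwap]
        at h01 h11
      simp [Matrix.mul_apply, Fin.sum_univ_two] at h01 h11
      congr 1
      ext
      apply mul_left_cancel₀ (hr0 r')
      linear_combination h11 - r.1 * h01
  subst ho
  exact ⟨rfl, mk_torus_injective (mul_left_cancel h)⟩

theorem card_root [IsAlgClosed k] (h2 : (2 : k) ≠ 0) (h3 : (3 : k) ≠ 0) {c : k} (hc : c ^ 3 ≠ 2) :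
    Nat.card (Root c) = 3 := by
  let P : Polynomial k := .C 2 * .X ^ 3 + .C (3 * c) * .X ^ 2 + .C 0 * .X + .C (-2)
  have hdeg : P.natDegree = 3 := Polynomial.natDegree_cubic h2
  have hsep : P.Separable := by
    have h12 : (12 : k) ≠ 0 := by
      rw [show (12 : k) = 2 * 2 * 3 by norm_num]
      exact mul_ne_zero (mul_ne_zero h2 h2) h3
    have he := inv_mul_cancel₀ (mul_ne_zero h12 (sub_ne_zero.2 hc.symm))
    set e := (12 * (2 - c ^ 3))⁻¹
    have he' := congrArg (Polynomial.C (R := k)) he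
    simp only [map_mul, map_sub, map_pow, map_one, map_ofNat] at he'
    -- the Euclidean algorithm for `P` and its derivative
    refine ⟨.C e * 6 * (.C c ^ 2 * .X + .C c ^ 3 - 2), .C e * (.C c ^ 4 -
      (2 * .X + .C c) * (.C c ^ 2 * .X + .C c ^ 3 - 2)), ?_⟩
    simp only [P, map_mul, map_neg, map_zero, map_ofNat, Polynomial.derivative_add,
      Polynomial.derivative_mul, Polynomial.derivative_X_pow, Polynomial.derivative_C,
      Polynomial.derivative_ofNat, Polynomial.derivative_X]
    push_cast
    simp only [map_ofNat]
    linear_combination he'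
  have hcard := Polynomial.card_rootSet_eq_natDegree (K := k) hsep (IsAlgClosed.splits _)
  rw [hdeg, ← Nat.card_eq_fintype_card] at hcard
  rw [← hcard]
  refine Nat.card_congr (Equiv.subtypeEquivRight fun r => ?_)
  have hP : P ≠ 0 := by
    rintro h
    simp [h] at hdeg
  rw [Polynomial.mem_rootSet_of_ne hP, Polynomial.coe_aeval_eq_eval]
  simp only [P, Polynomial.eval_add, Polynomial.eval_mul, Polynomial.eval_C, Polynomial.eval_X,
    Polynomial.eval_pow]
  constructor <;> intro h <;> linear_combination h

theorem card_stabilizer_normalPencil [IsAlgClosed k] (h2 : (2 : k) ≠ 0) (h3 : (3 : k) ≠ 0) {c : k}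
    (hc : c ^ 3 ≠ 2) : Nat.card (MulAction.stabilizer PGL(2, k) (normalPencil c)) =
      4 * Nat.card (TorusStab c) := by
  have hfin : Finite (Root c) := Nat.finite_of_card_ne_zero (by rw [card_root h2 h3 hc]; norm_num)
  rw [show 4 = Nat.card (Option (Root c)) by rw [Finite.card_option, card_root h2 h3 hc],
    ← Nat.card_prod]
  have hmem : ∀ oz : Option (Root c) × TorusStab c, rootSwapPGL h2 h3 hc oz.1 *
      mk (torus oz.2.1) ∈ MulAction.stabilizer PGL(2, k) (normalPencil c) := fun oz => by
    rw [MulAction.mem_stabilizer_iff, mul_smul, mk_smul_pencil,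
      torus_smul_normalPencil oz.2.2.1 oz.2.2.2, rootSwapPGL_smul]
  refine (Nat.card_congr (Equiv.ofBijective (fun oz => ⟨_, hmem oz⟩) ⟨?_, ?_⟩)).symm
  · rintro ⟨o, z⟩ ⟨o', z'⟩ h
    obtain ⟨rfl, hz⟩ := rootSwapPGL_mul_injective h2 h3 hc (congrArg Subtype.val h)
    exact Prod.ext rfl (Subtype.ext hz)
  · rintro ⟨x, hx⟩
    obtain ⟨o, z, rfl⟩ := exists_eq_rootSwapPGL_mul h2 h3 hc hx
    exact ⟨(o, z), rfl⟩

theorem torusStab_eq_one {c : k} (hc : c ≠ 0) (z : TorusStab c) : z.1 = 1 := by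
  obtain ⟨z, hz, hcz⟩ := z
  have h : z ^ 2 = 1 := by
    ext
    rw [Units.val_pow_eq_pow_val, Units.val_one]
    exact mul_left_cancel₀ hc (by rw [hcz, mul_one])
  rw [pow_succ, h, one_mul] at hz
  exact hz

theorem isKleinFour_stabilizer_normalPencil [IsAlgClosed k] (h2 : (2 : k) ≠ 0) (h3 : (3 : k) ≠ 0)
    {c : k} (hc : c ^ 3 ≠ 2) (hc0 : c ≠ 0) :
    IsKleinFour (MulAction.stabilizer PGL(2, k) (normalPencil c)) := by
  have hcard : Nat.card (MulAction.stabilizer PGL(2, k) (normalPencil c)) = 4 := by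
    have : Nat.card (TorusStab c) = 1 := by
      have : Subsingleton (TorusStab c) := ⟨fun z w => Subtype.ext
        ((torusStab_eq_one hc0 z).trans (torusStab_eq_one hc0 w).symm)⟩
      have : Nonempty (TorusStab c) := ⟨⟨1, by simp⟩⟩
      exact Nat.card_of_subsingleton (Classical.arbitrary _)
    rw [card_stabilizer_normalPencil h2 h3 hc, this]
  have : Nontrivial (MulAction.stabilizer PGL(2, k) (normalPencil c)) :=
    (Nat.finite_of_card_ne_zero (by omega)).one_lt_card_iff_nontrivial.1 (by omega)
  refine ⟨hcard, (Monoid.exponent_eq_prime_iff Nat.prime_two).2 fun x hx1 => ?_⟩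
  refine orderOf_eq_prime ?_ hx1
  obtain ⟨x, hx⟩ := x
  obtain ⟨o, z, rfl⟩ := exists_eq_rootSwapPGL_mul h2 h3 hc hx
  ext
  rw [SubmonoidClass.coe_pow, pow_two]
  simp only [torusStab_eq_one hc0 z, map_one, mul_one]
  exact rootSwapPGL_mul_self h2 h3 hc o

/-! ### The alternating group on four letters -/

/-- A group of order twelve acts on the cosets of a subgroup of order three. If the action is
faithful, the group is a subgroup of index two in a symmetric group on four letters. -/
theorem nonempty_mulEquiv_alternatingGroup {G : Type*} [Group G] (H : Subgroup G)
    (hG : Nat.card G = 12) (hH : Nat.card H = 3) (hcore : H.normalCore = ⊥) :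
    Nonempty (G ≃* alternatingGroup (Fin 4)) := by
  classical
  have hindex : Nat.card (G ⧸ H) = 4 := by
    have := H.card_mul_index
    rw [hH, hG] at this
    rw [← Subgroup.index_eq_card]
    omega
  have : Finite (G ⧸ H) := Nat.finite_of_card_ne_zero (by omega)
  have := Fintype.ofFinite (G ⧸ H)
  have hinj : Function.Injective (MulAction.toPermHom G (G ⧸ H)) := by
    rw [← MonoidHom.ker_eq_bot_iff, ← Subgroup.normalCore_eq_ker, hcore]
  have hrange : (MulAction.toPermHom G (G ⧸ H)).range = alternatingGroup (G ⧸ H) := by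
    apply Equiv.Perm.eq_alternatingGroup_of_index_eq_two
    have := (MulAction.toPermHom G (G ⧸ H)).range.card_mul_index
    rw [Nat.card_perm, hindex, ← Nat.card_congr (MonoidHom.ofInjective hinj).toEquiv, hG] at this
    simp [Nat.factorial] at this
    omega
  exact ⟨((MonoidHom.ofInjective hinj).trans (MulEquiv.subgroupCongr hrange)).trans
    (Equiv.altCongrHom (Finite.equivFinOfCardEq hindex))⟩

theorem nonempty_stabilizer_normalPencil_zero_mulEquiv [IsAlgClosed k] (h2 : (2 : k) ≠ 0)
    (h3 : (3 : k) ≠ 0) : Nonempty (MulAction.stabilizer PGL(2, k) (normalPencil (0 : k)) ≃*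
      alternatingGroup (Fin 4)) := by
  have hc : (0 : k) ^ 3 ≠ 2 := by
    rw [zero_pow (by norm_num)]
    exact h2.symm
  have : NeZero ((3 : ℕ) : k) := ⟨by exact_mod_cast h3⟩
  have h3' : Nat.card (rootsOfUnity 3 k) = 3 := HasEnoughRootsOfUnity.natCard_rootsOfUnity k 3
  have hT : Nat.card (TorusStab (0 : k)) = 3 := by
    rw [← h3']
    exact Nat.card_congr (Equiv.subtypeEquivRight fun z => by simp)
  let T : Subgroup PGL(2, k) := (rootsOfUnity 3 k).map (mk.comp torus)
  have hT' : Nat.card T = 3 := by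
    rw [← h3']
    exact (Nat.card_congr
      ((rootsOfUnity 3 k).equivMapOfInjective (mk.comp torus) mk_torus_injective).toEquiv).symm
  have hle : T ≤ MulAction.stabilizer PGL(2, k) (normalPencil (0 : k)) := by
    rintro _ ⟨z, hz, rfl⟩
    exact torus_smul_normalPencil hz (by simp)
  refine nonempty_mulEquiv_alternatingGroup
    (T.subgroupOf (MulAction.stabilizer PGL(2, k) (normalPencil (0 : k)))) ?_ ?_ ?_
  · rw [card_stabilizer_normalPencil h2 h3 hc, hT]
  · rw [← hT']
    exact Nat.card_congr (Subgroup.subgroupOfEquivOfLe hle).toEquiv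
  · rw [eq_bot_iff]
    rintro ⟨x, hx⟩ hxT
    -- a conjugate of a nontrivial diagonal element under the involution `∞ ↔ 1` is not diagonal
    have hr : (2 : k) * 1 ^ 3 + 3 * 0 * 1 ^ 2 = 2 := by ring
    have hd := rootSwap_det_ne_zero h2 h3 hc hr
    obtain ⟨z, -, hz⟩ := Subgroup.normalCore_le _ hxT
    obtain ⟨w, -, hw⟩ := hxT ⟨mk (rootSwap 1 hd), rootSwap_smul_normalPencil hd hr⟩
    change mk (torus z) = x at hz
    change mk (torus w) = mk (rootSwap 1 hd) * x * (mk (rootSwap 1 hd))⁻¹ at hw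
    rw [← hz, eq_mul_inv_iff_mul_eq, ← map_mul, ← map_mul] at hw
    obtain ⟨u, hu⟩ := mk_eq_mk_iff_exists.1 hw
    have h00 := hu 0 0
    have h01 := hu 0 1
    have h11 := hu 1 1
    rw [Units.val_mul, Units.val_mul, coe_torus, coe_torus, coe_rootSwap] at h00 h01 h11
    simp [Matrix.mul_apply, Fin.sum_univ_two] at h00 h01 h11
    have hz1 : z = 1 := by
      ext
      rw [← h00, h01, Units.val_one]
    rw [Subgroup.mem_bot]
    ext
    change x = 1
    rw [← hz, hz1, map_one, map_one]

/-- Pencils in one orbit have isomorphic stabilizers. -/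
def stabilizerEquivOfSmulEq {p q : Pencil k} {A : GL (Fin 2) k} (h : A • p = q) :
    MulAction.stabilizer PGL(2, k) p ≃* MulAction.stabilizer PGL(2, k) q :=
  MulAction.stabilizerEquivStabilizer (g := mk A) h.symm

theorem nonempty_stabilizer_mulEquiv_alternatingGroup [IsAlgClosed k] (h2 : (2 : k) ≠ 0)
    (h3 : (3 : k) ≠ 0) {p : Pencil k} (hp : p ∈ orbitA4 k) :
    Nonempty (MulAction.stabilizer PGL(2, k) p ≃* alternatingGroup (Fin 4)) := by
  obtain ⟨A, hA⟩ := exists_smul_eq_normalPencil_zero h2 h3 hp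
  exact (nonempty_stabilizer_normalPencil_zero_mulEquiv h2 h3).map
    (stabilizerEquivOfSmulEq hA).trans

theorem nonempty_stabilizer_mulEquiv_of_isStable [IsAlgClosed k] (h2 : (2 : k) ≠ 0)
    (h3 : (3 : k) ≠ 0) {p : Pencil k} (hs : IsStable p) (hp : p ∉ orbitA4 k) :
    Nonempty (MulAction.stabilizer PGL(2, k) p ≃* Multiplicative (ZMod 2 × ZMod 2)) := by
  obtain ⟨A, c, hA, hc⟩ := exists_smul_eq_normalPencil_of_isStable h2 h3 hs
  have hc0 : c ≠ 0 := fun h => hp <| by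
    rw [← smul_mem_orbitA4_iff h2 h3 A, hA, normalPencil_mem_orbitA4_iff h2 h3, h]
  have := isKleinFour_stabilizer_normalPencil h2 h3 hc hc0
  exact (IsKleinFour.nonempty_mulEquiv (G₂ := Multiplicative (ZMod 2 × ZMod 2))).map
    (stabilizerEquivOfSmulEq hA).trans

theorem exists_subgroup_le_stabilizer_mulEquiv [IsAlgClosed k] (h2 : (2 : k) ≠ 0)
    (h3 : (3 : k) ≠ 0) {p : Pencil k} (hp : p ∈ orbitA4 k) :
    ∃ H : Subgroup PGL(2, k), H ≤ MulAction.stabilizer PGL(2, k) p ∧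
      Nonempty (H ≃* Multiplicative (ZMod 2 × ZMod 2)) := by
  obtain ⟨e⟩ := nonempty_stabilizer_mulEquiv_alternatingGroup h2 h3 hp
  have : IsKleinFour (alternatingGroup.kleinFour (Fin 4)) :=
    alternatingGroup.kleinFour_isKleinFour (by simp)
  let φ : alternatingGroup (Fin 4) →* PGL(2, k) :=
    (MulAction.stabilizer PGL(2, k) p).subtype.comp e.symm.toMonoidHom
  have hφ : Function.Injective φ := Subtype.val_injective.comp e.symm.injective
  refine ⟨(alternatingGroup.kleinFour (Fin 4)).map φ, ?_, ?_⟩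
  · rintro _ ⟨x, -, rfl⟩
    exact (e.symm x).2
  · exact (IsKleinFour.nonempty_mulEquiv (G₁ := alternatingGroup.kleinFour (Fin 4))
      (G₂ := Multiplicative (ZMod 2 × ZMod 2))).map
      ((alternatingGroup.kleinFour (Fin 4)).equivMapOfInjective φ hφ).symm.trans

end BinaryCubicPencil

end

open BinaryCubicPencil in
theorem mainTheorem6 (k : Type*) [Field k] [IsAlgClosed k]
    (h2 : ringChar k ≠ 2) (h3 : ringChar k ≠ 3) :
    (∃ p₀ : Pencil k, orbitA4 k = MulAction.orbit PGL(2, k) p₀) ∧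
    (∀ p : Pencil k, IsStable p → p ∉ orbitA4 k →
      Nonempty (MulAction.stabilizer PGL(2, k) p ≃* Multiplicative (ZMod 2 × ZMod 2))) ∧
    (∀ p : Pencil k, IsStable p → p ∈ orbitA4 k →
      ∃ H : Subgroup PGL(2, k), H ≤ MulAction.stabilizer PGL(2, k) p ∧
        Nonempty (H ≃* Multiplicative (ZMod 2 × ZMod 2))) ∧
    (∀ p ∈ orbitA4 k,
      Nonempty (MulAction.stabilizer PGL(2, k) p ≃* alternatingGroup (Fin 4))) := by
  have h2' : (2 : k) ≠ 0 := Ring.two_ne_zero h2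
  have h3' : (3 : k) ≠ 0 := fun h => h3 (CharP.ringChar_of_prime_eq_zero Nat.prime_three
    (by exact_mod_cast h))
  exact ⟨⟨_, orbitA4_eq_orbit h2' h3'⟩,
    fun _ hs hp => nonempty_stabilizer_mulEquiv_of_isStable h2' h3' hs hp,
    fun _ _ hp => exists_subgroup_le_stabilizer_mulEquiv h2' h3' hp,
    fun _ hp => nonempty_stabilizer_mulEquiv_alternatingGroup h2' h3' hp⟩
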